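/- **Definitions.** A set $\Delta$ of positive real numbers is a *distance value set* if $\min\{x+y,\sup\Delta\}\in\Delta$ for all $x,y\in\Delta$ (with $\sup\Delta=+\infty$ if $\Delta$ is unbounded). A triple $(x,y,z)$ is a *$\Delta$-triangle* if $x,y,z\in\Delta$ and $|x-y|\le z\le x+y$. Distance value sets $\Delta$ and $\Lambda$ are *equivalent* if there is a bijection $f\colon\Delta\to\Lambda$ such that for all $x,y,z\in\Delta$, $(x,y,z)$ is a $\Delta$-triangle if and only if $(f(x),f(y),f(z))$ is a $\Lambda$-triangle. A *finite ordered $\Delta$-metric space* is a finite metric space $(X,d)$ with $d(x,y)\in\Delta$ for all $x\ne y$, together with a linear order $<$ on $X$; it is regarded as a relational structure $(X;(R_s)_{s\in\Delta},<)$, where $R_s(x,y)$ holds iff $d(x,y)=s$. For countable $\Delta$, $\mathbb{U}^{<}_\Delta$ denotes the Fraïssé limit of the class of all finite ordered $\Delta$-metric spaces, that is, the (unique up to isomorphism) countable ultrahomogeneous structure whose age is this class. Its automorphism group $\mathrm{Aut}(\mathbb{U}^{<}_\Delta)$ carries the topology of pointwise convergence, the underlying set of $\mathbb{U}^{<}_\Delta$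 being discrete. **Theorem.** Let $\Delta$ and $\Lambda$ be countable distance value sets. Then the Fraïssé limits $\mathbb{U}^{<}_\Delta$ and $\mathbb{U}^{<}_\Lambda$ exist, and the following are equivalent: 1. $\mathrm{Aut}(\mathbb{U}^{<}_\Delta)$ and $\mathrm{Aut}(\mathbb{U}^{<}_\Lambda)$ are isomorphic as topological groups. 2. $\Delta$ and $\Lambda$ are equivalent. -/

import Mathlib

open scoped FirstOrder

namespace OrderedUrysohn

/-- A distance value set: a set of positive reals such that `min {x + y, sup Δ} ∈ Δ` for all
`x, y ∈ Δ`. The supremum is taken in the extended reals, so it is `+∞` when `Δ` is unbounded. -/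
structure IsDistanceValueSet (Δ : Set ℝ) : Prop where
  pos : ∀ x ∈ Δ, 0 < x
  min_mem : ∀ x ∈ Δ, ∀ y ∈ Δ,
    ∃ z ∈ Δ, (z : EReal) = min ((x + y : ℝ) : EReal) (⨆ s ∈ Δ, (s : EReal))

/-- `(x, y, z)` is a `Δ`-triangle. -/
def IsTriangle (Δ : Set ℝ) (x y z : ℝ) : Prop :=
  x ∈ Δ ∧ y ∈ Δ ∧ z ∈ Δ ∧ |x - y| ≤ z ∧ z ≤ x + y

/-- `Δ` and `Λ` are equivalent: some bijection `Δ → Λ` preserves triangles in both directions. -/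
def Equivalent (Δ Λ : Set ℝ) : Prop :=
  ∃ f : Δ ≃ Λ, ∀ x y z : Δ, IsTriangle Δ x y z ↔ IsTriangle Λ (f x) (f y) (f z)

/-- The relation symbols of ordered `Δ`-metric spaces: a binary symbol for each `s ∈ Δ`,
and a binary symbol for the order. -/
inductive Rel (Δ : Set ℝ) : ℕ → Type
  | dist (s : Δ) : Rel Δ 2
  | lt : Rel Δ 2

/-- The relational language of ordered `Δ`-metric spaces. -/
def language (Δ : Set ℝ) : FirstOrder.Language.{0, 0} where
  Functions := fun _ => Empty
  Relations := Rel Δ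

/-- The symbol for "the distance is `s`". -/
def distSymb {Δ : Set ℝ} (s : Δ) : (language Δ).Relations 2 := Rel.dist s

/-- The symbol for the strict order. -/
def ltSymb {Δ : Set ℝ} : (language Δ).Relations 2 := Rel.lt

instance (Δ : Set ℝ) : (language Δ).IsRelational :=
  fun _ => inferInstanceAs (IsEmpty Empty)

instance (Δ : Set ℝ) : Countable (Σ n, (language Δ).Functions n) :=
  have : IsEmpty (Σ n, (language Δ).Functions n) := ⟨fun p => Empty.elim p.2⟩
  inferInstance

/-- A structure is an ordered `Δ`-metric space if it comes from a metric all of whose nonzero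
distances lie in `Δ`, and a linear order: the symbol of `s` is interpreted as `d(x, y) = s`
and the order symbol as the strict order `x < y`. -/
def IsOrderedMetricSpace (Δ : Set ℝ) (X : Type) [(language Δ).Structure X] : Prop :=
  ∃ (_ : MetricSpace X) (_ : LinearOrder X),
    (∀ x y : X, x ≠ y → dist x y ∈ Δ) ∧
    (∀ (s : Δ) (x y : X),
      FirstOrder.Language.Structure.RelMap (distSymb s) ![x, y] ↔ dist x y = s) ∧
    (∀ x y : X, FirstOrder.Language.Structure.RelMap (ltSymb (Δ := Δ)) ![x, y] ↔ x < y)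

/-- The class of all finite ordered `Δ`-metric spaces. -/
def finiteOrderedMetricSpaces (Δ : Set ℝ) : Set (CategoryTheory.Bundled.{0} (language Δ).Structure) :=
  {X | Finite X ∧ IsOrderedMetricSpace Δ X}

/-- `U` is the ordered `Δ`-Urysohn space: the (countable) Fraïssé limit of the class of all
finite ordered `Δ`-metric spaces. -/
def IsOrderedUrysohnSpace (Δ : Set ℝ) (U : Type) [(language Δ).Structure U] : Prop :=
  ∃ _ : Countable U, FirstOrder.Language.IsFraisseLimit (finiteOrderedMetricSpaces Δ) U

/-- The automorphism group of a first-order structure. -/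
def Aut (L : FirstOrder.Language.{0, 0}) (M : Type) [L.Structure M] : Type := M ≃[L] M

namespace Aut

variable {L : FirstOrder.Language.{0, 0}} {M : Type} [L.Structure M]

/-- An automorphism as a map. -/
def toFun (g : Aut L M) : M → M := FirstOrder.Language.Equiv.toEquiv g

theorem ext {g h : Aut L M} (H : ∀ x, g.toFun x = h.toFun x) : g = h :=
  FirstOrder.Language.Equiv.ext H

/-- The group operation is composition. -/
instance : Group (Aut L M) where
  mul g h := FirstOrder.Language.Equiv.comp g h
  one := FirstOrder.Language.Equiv.refl L M
  inv g := FirstOrder.Language.Equiv.symm g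
  mul_assoc _ _ _ := rfl
  one_mul _ := rfl
  mul_one _ := rfl
  inv_mul_cancel g := FirstOrder.Language.Equiv.symm_comp_self g

/-- The topology of pointwise convergence, where `M` is discrete. -/
instance : TopologicalSpace (Aut L M) :=
  TopologicalSpace.induced toFun (@Pi.topologicalSpace M (fun _ => M) (fun _ => ⊥))

end Aut

end OrderedUrysohn

/-! Everything rests on the extension property `IsUrysohn`: every Katětov function on a finite
subset with values in the distance set, together with every cut of that subset, is realised by a
point. A countable space with this property is built stage by stage (`exists_isUrysohn`). Back and
forth shows it is the Fraïssé limit, so by uniqueness every ordered Urysohn space has the property.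

Equivalent sets give isomorphic groups. Replacing each distance by its image under the equivalence
keeps the triangle inequalities and the extension property. The new space is thus the limit for the
other set, while the order and the partition of pairs by distance are unchanged. Conjugation is then
an isomorphism of topological groups.

Conversely, the points are recovered from the topological group. The crux is
`IsUrysohn.exists_mem_smul_eq`: no subgroup lies strictly between the stabiliser of a finite set and
that of the set with one point added. If a subgroup moves the point `a` by distance `r`, its orbit
spreads over the whole type of `a` through midpoints at distances `r`, `2r`, `4r` and so on. Since
the order makes finite sets rigid, every open subgroup is the pointwise stabiliser of a finite set
(`exists_eq_fixingSubgroup`), and point stabilisers are maximal among proper subgroups. An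
isomorphism of the groups therefore comes from an equivariant bijection of the points
(`exists_equiv`).

Orbits of pairs are determined by distance and order, and reversing a pair does not change its
distance, so the bijection induces a map of distances. Each triangle is realised by three points,
hence this map and its inverse preserve triangles. -/

namespace OrderedUrysohn

/-! ### Distance value sets -/

namespace IsDistanceValueSet

variable {Δ : Set ℝ}

theorem exists_truncated_add (hΔ : IsDistanceValueSet Δ) {x y : ℝ} (hx : x ∈ Δ) (hy : y ∈ Δ) :
    ∃ z ∈ Δ, z ≤ x + y ∧ (z = x + y ∨ ∀ t ∈ Δ, t ≤ z) := by
  obtain ⟨z, hz, h⟩ := hΔ.min_mem x hx y hy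
  refine ⟨z, hz, ?_, ?_⟩
  · exact EReal.coe_le_coe_iff.1 (h ▸ min_le_left _ _)
  · rcases min_choice ((x + y : ℝ) : EReal) (⨆ s ∈ Δ, (s : EReal)) with h' | h'
    · exact Or.inl (EReal.coe_injective (h.trans h'))
    · refine Or.inr fun t ht => EReal.coe_le_coe_iff.1 ?_
      rw [h, h']
      exact le_iSup₂ (f := fun (s : ℝ) (_ : s ∈ Δ) => (s : EReal)) t ht

theorem two_mul_mem (hΔ : IsDistanceValueSet Δ) {s t : ℝ} (hs : s ∈ Δ) (ht : t ∈ Δ)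
    (h : 2 * s ≤ t) : 2 * s ∈ Δ := by
  obtain ⟨z, hz, hle, h' | h'⟩ := hΔ.exists_truncated_add hs hs
  · rwa [two_mul, ← h']
  · have := h' t ht
    rwa [show 2 * s = z by linarith]

/-- Supplies the midpoint distances for the doubling argument in `exists_mem_smul_eq`. -/
theorem two_pow_mul_mem (hΔ : IsDistanceValueSet Δ) {s t : ℝ} (hs : s ∈ Δ) (ht : t ∈ Δ) (n : ℕ)
    (h : 2 ^ n * s ≤ t) : 2 ^ n * s ∈ Δ := by
  induction n with
  | zero => simpa using hs
  | succ n ih =>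
    have hpos := hΔ.pos s hs
    have h2 : (0 : ℝ) < 2 ^ n * s := by positivity
    rw [pow_succ] at h ⊢
    have := hΔ.two_mul_mem (ih (by linarith)) ht (by linarith)
    convert this using 1
    ring

/-- Truncation at the largest element of `Δ`, if there is one. -/
theorem exists_truncation (Δ : Set ℝ) (t : ℝ) :
    ∃ u ≤ t, (u = t ∧ ¬ ∃ m ∈ Δ, (∀ x ∈ Δ, x ≤ m) ∧ m < t) ∨
      (u ∈ Δ ∧ ∀ x ∈ Δ, x ≤ u) := by
  by_cases h : ∃ m ∈ Δ, (∀ x ∈ Δ, x ≤ m) ∧ m < t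
  · obtain ⟨m, hm, hmax, hlt⟩ := h
    exact ⟨m, hlt.le, Or.inr ⟨hm, hmax⟩⟩
  · exact ⟨t, le_rfl, Or.inl ⟨rfl, h⟩⟩

/-- When the truncation of `x + y` is proper, the truncated value lies in `Δ` and is its maximum;
nothing else can keep the sum out of `Δ`. -/
theorem add_mem_of_not_exists (hΔ : IsDistanceValueSet Δ) {x y : ℝ} (hx : x ∈ Δ) (hy : y ∈ Δ)
    (h : ¬ ∃ m ∈ Δ, (∀ t ∈ Δ, t ≤ m) ∧ m < x + y) : x + y ∈ Δ := by
  obtain ⟨z, hz, hle, h' | h'⟩ := hΔ.exists_truncated_add hx hy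
  · exact h' ▸ hz
  · rcases hle.lt_or_eq with h2 | h2
    · exact absurd ⟨z, hz, h', h2⟩ h
    · exact h2 ▸ hz

end IsDistanceValueSet

/-! ### Existence of a countable ordered `Δ`-metric space with the extension property -/

/-- A metric space with a linear order whose nonzero distances lie in `Δ` and which realises all
one-point extensions of its finite subspaces. -/
structure IsUrysohn (Δ : Set ℝ) (U : Type) [MetricSpace U] [LinearOrder U] : Prop where
  dist_mem : ∀ x y : U, x ≠ y → dist x y ∈ Δ
  extension : ∀ (F : Finset U) (h : U → ℝ) (P : U → Prop), (∀ x ∈ F, h x ∈ Δ) →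
    (∀ x ∈ F, ∀ y ∈ F, |h x - h y| ≤ dist x y ∧ dist x y ≤ h x + h y) →
    (∀ x ∈ F, ∀ y ∈ F, x < y → P y → P x) →
    ∃ z, ∀ x ∈ F, dist z x = h x ∧ (x < z ↔ P x)

namespace Construction

/-- The first `n` natural numbers form an ordered `Δ`-metric space with distance `d`, the order
being that of the labels `q`. -/
structure IsStage (Δ : Set ℝ) (n : ℕ) (d : ℕ → ℕ → ℝ) (q : ℕ → ℚ) : Prop where
  self : ∀ i < n, d i i = 0
  mem : ∀ i < n, ∀ j < n, i ≠ j → d i j ∈ Δ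
  symm : ∀ i < n, ∀ j < n, d i j = d j i
  triangle : ∀ i < n, ∀ j < n, ∀ k < n, d i k ≤ d i j + d j k
  inj : ∀ i < n, ∀ j < n, q i = q j → i = j

theorem isStage_zero (Δ : Set ℝ) (d : ℕ → ℕ → ℝ) (q : ℕ → ℚ) : IsStage Δ 0 d q := by
  constructor <;> intro i hi <;> exact absurd hi (Nat.not_lt_zero i)

/-- A finite set of prescribed distances together with an interval of labels. -/
abbrev Task (Δ : Set ℝ) : Type := Finset (ℕ × Δ) × ℚ × ℚ

/-- The task describes a one-point extension of a nonempty subspace of the first `n` points. -/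
structure Applicable {Δ : Set ℝ} (n : ℕ) (d : ℕ → ℕ → ℝ) (t : Task Δ) : Prop where
  nonempty : t.1.Nonempty
  lt : ∀ a ∈ t.1, a.1 < n
  katetov : ∀ a ∈ t.1, ∀ b ∈ t.1,
    |(a.2 : ℝ) - b.2| ≤ d a.1 b.1 ∧ d a.1 b.1 ≤ a.2 + b.2
  interval : t.2.1 < t.2.2

variable {Δ : Set ℝ}

/-- The largest Katětov extension `i ↦ min (d i a + value at a)` works once it is cut off at the
maximum of `Δ`, if there is one. An uncut value is a prescribed distance or a sum of two elements of
`Δ` not above a maximum, so it lies in `Δ`. The cut keeps both inequalities because no distance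
exceeds the maximum. -/
theorem exists_katetov_extension (hΔ : IsDistanceValueSet Δ) {n : ℕ} {d : ℕ → ℕ → ℝ} {q : ℕ → ℚ}
    (hs : IsStage Δ n d q) {t : Task Δ} (ht : Applicable n d t) :
    ∃ h : ℕ → ℝ, (∀ i < n, h i ∈ Δ) ∧ (∀ a ∈ t.1, h a.1 = a.2) ∧
      ∀ i < n, ∀ j < n, h i ≤ h j + d i j ∧ d i j ≤ h i + h j := by
  have hmin : ∀ i, ∃ a ∈ t.1, ∀ b ∈ t.1, d i a.1 + (a.2 : ℝ) ≤ d i b.1 + b.2 := fun i =>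
    t.1.exists_min_image (fun a => d i a.1 + (a.2 : ℝ)) ht.nonempty
  choose J hJ hJmin using hmin
  set e : ℕ → ℝ := fun i => d i (J i).1 + (J i).2 with he
  choose T hTle hT using fun i => IsDistanceValueSet.exists_truncation Δ (e i)
  have he_lip : ∀ i < n, ∀ j < n, e i ≤ e j + d i j := fun i hi j hj => by
    have h1 := hJmin i (J j) (hJ j)
    have h2 := hs.triangle i hi j hj (J j).1 (ht.lt _ (hJ j))
    simp only [he]
    linarith
  have he_add : ∀ i < n, ∀ j < n, d i j ≤ e i + e j := fun i hi j hj => by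
    have h1 := hs.triangle i hi (J i).1 (ht.lt _ (hJ i)) j hj
    have h2 := hs.triangle (J i).1 (ht.lt _ (hJ i)) (J j).1 (ht.lt _ (hJ j)) j hj
    have h3 := (ht.katetov _ (hJ i) _ (hJ j)).2
    have h4 := hs.symm j hj (J j).1 (ht.lt _ (hJ j))
    simp only [he]
    linarith
  have he_eq : ∀ a ∈ t.1, e a.1 = a.2 := fun a ha => by
    have h1 := hJmin a.1 a ha
    have h2 := hs.self a.1 (ht.lt a ha)
    have h3 := abs_le.1 (ht.katetov _ ha _ (hJ a.1)).1
    simp only [he]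
    linarith [h3.2]
  have hd_nonneg : ∀ i < n, ∀ j < n, 0 ≤ d i j := fun i hi j hj => by
    rcases eq_or_ne i j with rfl | hij
    · exact (hs.self i hi).ge
    · exact (hΔ.pos _ (hs.mem i hi j hj hij)).le
  have hpos : ∀ i < n, 0 < e i := fun i hi =>
    add_pos_of_nonneg_of_pos (hd_nonneg i hi _ (ht.lt _ (hJ i))) (hΔ.pos _ (J i).2.2)
  have hmemT : ∀ i < n, T i ∈ Δ := fun i hi => by
    rcases hT i with ⟨h1, h2⟩ | h
    · rw [h1]
      rcases eq_or_ne i (J i).1 with hij | hij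
      · have h0 : d i (J i).1 = 0 := by rw [← hij]; exact hs.self i hi
        simp only [he, h0, zero_add]
        exact (J i).2.2
      · exact hΔ.add_mem_of_not_exists (hs.mem i hi _ (ht.lt _ (hJ i)) hij) (J i).2.2 h2
    · exact h.1
  refine ⟨T, hmemT, ?_, ?_⟩
  · intro a ha
    rcases hT a.1 with ⟨h1, -⟩ | h
    · rw [h1, he_eq a ha]
    · exact le_antisymm ((hTle _).trans (he_eq a ha).le) (h.2 _ a.2.2)
  · intro i hi j hj
    have hdle : ∀ u ∈ Δ, (∀ x ∈ Δ, x ≤ u) → d i j ≤ u := fun u hu hmax => by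
      rcases eq_or_ne i j with rfl | hij
      · rw [hs.self i hi]; exact (hΔ.pos u hu).le
      · exact hmax _ (hs.mem i hi j hj hij)
    have hTi := hΔ.pos _ (hmemT i hi)
    have hTj := hΔ.pos _ (hmemT j hj)
    constructor
    · rcases hT j with ⟨h1, -⟩ | h
      · rw [h1]; exact (hTle i).trans (he_lip i hi j hj)
      · have := h.2 _ (hmemT i hi)
        have := hd_nonneg i hi j hj
        linarith
    · rcases hT i with ⟨h1, -⟩ | h
      · rcases hT j with ⟨h1', -⟩ | h'
        · rw [h1, h1']; exact he_add i hi j hj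
        · have := hdle _ h'.1 h'.2
          linarith
      · have := hdle _ h.1 h.2
        linarith

theorem exists_realization (hΔ : IsDistanceValueSet Δ) {n : ℕ} {d : ℕ → ℕ → ℝ} {q : ℕ → ℚ}
    (hs : IsStage Δ n d q) {t : Task Δ} (ht : Applicable n d t) :
    ∃ d' q', IsStage Δ (n + 1) d' q' ∧ (∀ i < n, ∀ j < n, d' i j = d i j) ∧
      (∀ i < n, q' i = q i) ∧
      (∀ a ∈ t.1, d' n a.1 = a.2) ∧ t.2.1 < q' n ∧ q' n < t.2.2 := by
  obtain ⟨h, hmem, heq, hk⟩ := exists_katetov_extension hΔ hs ht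
  -- The label of the new point: an open rational interval is infinite, so it contains one not used
  -- so far.
  obtain ⟨c, hc, hcq⟩ :=
    (Set.Ioo_infinite ht.interval).exists_notMem_finset ((Finset.range n).image q)
  have hcq' : ∀ i < n, q i ≠ c := fun i hi hi' =>
    hcq (Finset.mem_image.2 ⟨i, Finset.mem_range.2 hi, hi'⟩)
  let d' : ℕ → ℕ → ℝ := fun i j =>
    if i = n then (if j = n then 0 else h j) else (if j = n then h i else d i j)
  have d1 : ∀ i < n, ∀ j < n, d' i j = d i j := fun i hi j hj => by
    simp [d', hi.ne, hj.ne]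
  have d2 : ∀ i < n, d' i n = h i := fun i hi => by simp [d', hi.ne]
  have d3 : ∀ i < n, d' n i = h i := fun i hi => by simp [d', hi.ne]
  have d4 : d' n n = 0 := by simp [d']
  refine ⟨d', Function.update q n c, ⟨?_, ?_, ?_, ?_, ?_⟩, d1, ?_, ?_, ?_⟩
  · intro i hi
    rcases Nat.lt_succ_iff_lt_or_eq.1 hi with hi | rfl
    · rw [d1 i hi i hi, hs.self i hi]
    · exact d4
  · intro i hi j hj hij
    rcases Nat.lt_succ_iff_lt_or_eq.1 hi with hi | rfl <;>
      rcases Nat.lt_succ_iff_lt_or_eq.1 hj with hj | rfl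
    · rw [d1 i hi j hj]; exact hs.mem i hi j hj hij
    · rw [d2 i hi]; exact hmem i hi
    · rw [d3 j hj]; exact hmem j hj
    · exact absurd rfl hij
  · intro i hi j hj
    rcases Nat.lt_succ_iff_lt_or_eq.1 hi with hi | rfl <;>
      rcases Nat.lt_succ_iff_lt_or_eq.1 hj with hj | rfl
    · rw [d1 i hi j hj, d1 j hj i hi]; exact hs.symm i hi j hj
    · rw [d2 i hi, d3 i hi]
    · rw [d2 j hj, d3 j hj]
    · rfl
  · intro i hi j hj k hkn
    rcases Nat.lt_succ_iff_lt_or_eq.1 hi with hi | rfl <;>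
      rcases Nat.lt_succ_iff_lt_or_eq.1 hj with hj | rfl <;>
      rcases Nat.lt_succ_iff_lt_or_eq.1 hkn with hkn | rfl
    · rw [d1 i hi j hj, d1 j hj k hkn, d1 i hi k hkn]; exact hs.triangle i hi j hj k hkn
    · rw [d1 i hi j hj, d2 j hj, d2 i hi]; linarith [(hk i hi j hj).1]
    · rw [d2 i hi, d3 k hkn, d1 i hi k hkn]; exact (hk i hi k hkn).2
    · rw [d2 i hi, d4, add_zero]
    · rw [d3 j hj, d1 j hj k hkn, d3 k hkn, hs.symm j hj k hkn]
      linarith [(hk k hkn j hj).1]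
    · rw [d3 j hj, d2 j hj, d4]; linarith [hΔ.pos _ (hmem j hj)]
    · rw [d4, d3 k hkn, zero_add]
    · rw [d4, add_zero]
  · intro i hi j hj hij
    rcases Nat.lt_succ_iff_lt_or_eq.1 hi with hi | rfl <;>
      rcases Nat.lt_succ_iff_lt_or_eq.1 hj with hj | rfl
    · rw [Function.update_of_ne hi.ne, Function.update_of_ne hj.ne] at hij
      exact hs.inj i hi j hj hij
    · rw [Function.update_of_ne hi.ne, Function.update_self] at hij
      exact absurd hij (hcq' i hi)
    · rw [Function.update_of_ne hj.ne, Function.update_self] at hij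
      exact absurd hij.symm (hcq' j hj)
    · rfl
  · intro i hi
    exact Function.update_of_ne hi.ne _ _
  · intro a ha
    rw [d3 _ (ht.lt a ha), heq a ha]
  · rw [Function.update_self]
    exact ⟨hc.1, hc.2⟩

theorem exists_step (hΔ : IsDistanceValueSet Δ) (hne : Δ.Nonempty) {n : ℕ} {d : ℕ → ℕ → ℝ}
    {q : ℕ → ℚ} (hs : IsStage Δ n d q) (t : Task Δ) :
    ∃ d' q', IsStage Δ (n + 1) d' q' ∧ (∀ i < n, ∀ j < n, d' i j = d i j) ∧
      (∀ i < n, q' i = q i) ∧ (Applicable n d t →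
      (∀ a ∈ t.1, d' n a.1 = a.2) ∧ t.2.1 < q' n ∧ q' n < t.2.2) := by
  by_cases ht : Applicable n d t
  · obtain ⟨d', q', h1, h2, h3, h4⟩ := exists_realization hΔ hs ht
    exact ⟨d', q', h1, h2, h3, fun _ => h4⟩
  · rcases Nat.eq_zero_or_pos n with rfl | hn
    · refine ⟨fun _ _ => 0, q, ⟨?_, ?_, ?_, ?_, ?_⟩, ?_, ?_, fun h => absurd h ht⟩
      all_goals intros; first | rfl | omega | simp
    · obtain ⟨s, hs0⟩ := hne
      -- The stage must grow even when the task makes no sense, so a dummy task is carried out: a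
      -- point at distance `s` from point `0`, with an arbitrary label interval.
      have ht' : Applicable n d (({(0, ⟨s, hs0⟩)}, 0, 1) : Task Δ) := by
        refine ⟨by simp, by simpa using hn, ?_, by simp⟩
        have := hΔ.pos s hs0
        simp only [Finset.mem_singleton, forall_eq, sub_self, abs_zero, hs.self 0 hn, le_refl,
          true_and]
        linarith
      obtain ⟨d', q', h1, h2, h3, -⟩ := exists_realization hΔ hs ht'
      exact ⟨d', q', h1, h2, h3, fun h => absurd h ht⟩

/-- A coherent sequence of stages in which every task occurs cofinally. -/
theorem exists_generic (hΔ : IsDistanceValueSet Δ) (hne : Δ.Nonempty) (hc : Δ.Countable) :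
    ∃ (d : ℕ → ℕ → ℝ) (q : ℕ → ℚ), (∀ n, IsStage Δ n d q) ∧
      ∀ (t : Task Δ) (m : ℕ), (∀ n, m ≤ n → Applicable n d t) →
        ∃ n, (∀ a ∈ t.1, d n a.1 = a.2) ∧ t.2.1 < q n ∧ q n < t.2.2 := by
  have : Countable Δ := hc.to_subtype
  obtain ⟨τ, hτ⟩ := exists_surjective_nat (Task Δ)
  let S : ℕ → Type := fun n => {p : (ℕ → ℕ → ℝ) × (ℕ → ℚ) // IsStage Δ n p.1 p.2}
  have hstep : ∀ n (p : S n), ∃ p' : S (n + 1), (∀ i < n, ∀ j < n, p'.1.1 i j = p.1.1 i j) ∧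
      (∀ i < n, p'.1.2 i = p.1.2 i) ∧ (Applicable n p.1.1 (τ n.unpair.1) →
      (∀ a ∈ (τ n.unpair.1).1, p'.1.1 n a.1 = a.2) ∧ (τ n.unpair.1).2.1 < p'.1.2 n ∧
        p'.1.2 n < (τ n.unpair.1).2.2) := fun n p => by
    obtain ⟨d', q', h1, h2⟩ := exists_step hΔ hne p.2 (τ n.unpair.1)
    exact ⟨⟨(d', q'), h1⟩, h2⟩
  choose next hd hq hnext using hstep
  let s : ∀ n, S n := fun n => Nat.rec (motive := S)
    ⟨(fun _ _ => 0, fun _ => 0), isStage_zero Δ _ _⟩ (fun n p => next n p) n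
  have hs : ∀ n, s (n + 1) = next n (s n) := fun n => rfl
  have hsd : ∀ n k, ∀ i < n, ∀ j < n, (s (n + k)).1.1 i j = (s n).1.1 i j := fun n k => by
    induction k with
    | zero => intros; rfl
    | succ k ih =>
      intro i hi j hj
      rw [← ih i hi j hj, ← add_assoc, hs]
      exact hd _ _ i (by omega) j (by omega)
  have hsq : ∀ n k, ∀ i < n, (s (n + k)).1.2 i = (s n).1.2 i := fun n k => by
    induction k with
    | zero => intros; rfl
    | succ k ih =>
      intro i hi
      rw [← ih i hi, ← add_assoc, hs]
      exact hq _ _ i (by omega)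
  -- Values never change once defined, so the limit may be read off at any stage containing both
  -- points.
  let d : ℕ → ℕ → ℝ := fun i j => (s (i + j + 1)).1.1 i j
  let q : ℕ → ℚ := fun i => (s (i + 1)).1.2 i
  have hdn : ∀ n, ∀ i < n, ∀ j < n, (s n).1.1 i j = d i j := fun n i hi j hj => by
    have h1 := hsd n (i + j + 1) i hi j hj
    have h2 := hsd (i + j + 1) n i (by omega) j (by omega)
    rw [← h1, add_comm, h2]
  have hqn : ∀ n, ∀ i < n, (s n).1.2 i = q i := fun n i hi => by
    have h1 := hsq n (i + 1) i hi
    have h2 := hsq (i + 1) n i (by omega)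
    rw [← h1, add_comm, h2]
  refine ⟨d, q, fun n => ?_, fun t m ht => ?_⟩
  · have h := (s n).2
    refine ⟨?_, ?_, ?_, ?_, ?_⟩
    · intro i hi
      rw [← hdn n i hi i hi]; exact h.self i hi
    · intro i hi j hj hij
      rw [← hdn n i hi j hj]; exact h.mem i hi j hj hij
    · intro i hi j hj
      rw [← hdn n i hi j hj, ← hdn n j hj i hi]; exact h.symm i hi j hj
    · intro i hi j hj k hk
      rw [← hdn n i hi j hj, ← hdn n i hi k hk, ← hdn n j hj k hk]
      exact h.triangle i hi j hj k hk
    · intro i hi j hj hij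
      rw [← hqn n i hi, ← hqn n j hj] at hij
      exact h.inj i hi j hj hij
  · obtain ⟨c, rfl⟩ := hτ t
    -- Stage `Nat.pair c m` is at least `m` and treats the task numbered `c`.
    set n := Nat.pair c m with hn
    have hcn : n.unpair.1 = c := by simp [hn]
    have ha := ht n (Nat.right_le_pair c m)
    have := hnext n (s n) (by
      rw [hcn]
      refine ⟨ha.nonempty, ha.lt, fun a h b h' => ?_, ha.interval⟩
      rw [hdn n _ (ha.lt a h) _ (ha.lt b h')]
      exact ha.katetov a h b h')
    rw [hcn, ← hs] at this
    refine ⟨n, fun a h => ?_, ?_, ?_⟩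
    · rw [← hdn (n + 1) n (by omega) a.1 ((ha.lt a h).trans (by omega))]
      exact this.1 a h
    · rw [← hqn (n + 1) n (by omega)]; exact this.2.1
    · rw [← hqn (n + 1) n (by omega)]; exact this.2.2

/-- The carrier of the constructed space. -/
structure Point where
  /-- The index of the point. -/
  idx : ℕ

theorem Point.idx_injective : Function.Injective Point.idx := fun a b h => by
  cases a; cases b; simpa using h

instance : Countable Point := Point.idx_injective.countable

end Construction

open Construction in
theorem exists_isUrysohn {Δ : Set ℝ} (hΔ : IsDistanceValueSet Δ) (hc : Δ.Countable) :
    ∃ (U : Type) (_ : Countable U) (_ : MetricSpace U) (_ : LinearOrder U), IsUrysohn Δ U := by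
  rcases Δ.eq_empty_or_nonempty with rfl | hne
  · refine ⟨PUnit, inferInstance, inferInstance, inferInstance, ?_, ?_⟩
    · intro x y h
      exact absurd (Subsingleton.elim x y) h
    · intro F h P hmem _ _
      exact ⟨PUnit.unit, fun x hx => (hmem x hx).elim⟩
  · obtain ⟨d, q, hs, hgen⟩ := exists_generic hΔ hne hc
    have hself : ∀ i, d i i = 0 := fun i => (hs (i + 1)).self i (by omega)
    have hmem : ∀ i j, i ≠ j → d i j ∈ Δ := fun i j =>
      (hs (i + j + 1)).mem i (by omega) j (by omega)
    have hsymm : ∀ i j, d i j = d j i := fun i j =>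
      (hs (i + j + 1)).symm i (by omega) j (by omega)
    have htri : ∀ i j k, d i k ≤ d i j + d j k := fun i j k =>
      (hs (i + j + k + 1)).triangle i (by omega) j (by omega) k (by omega)
    have hinj : Function.Injective q := fun i j =>
      (hs (i + j + 1)).inj i (by omega) j (by omega)
    let iM : MetricSpace Point :=
      { dist := fun x y => d x.idx y.idx
        dist_self := fun x => hself x.idx
        dist_comm := fun x y => hsymm x.idx y.idx
        dist_triangle := fun x y z => htri x.idx y.idx z.idx
        eq_of_dist_eq_zero := fun {x y} h => by
          by_contra hxy
          exact (hΔ.pos _ (hmem x.idx y.idx fun h' => hxy (Point.idx_injective h'))).ne' h }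
    let iL : LinearOrder Point :=
      LinearOrder.lift' (fun x : Point => q x.idx) (hinj.comp Point.idx_injective)
    have hlt : ∀ x y : Point, x < y ↔ q x.idx < q y.idx := fun x y => Iff.rfl
    refine ⟨Point, inferInstance, iM, iL, ⟨fun x y hxy => ?_, fun F h P hh hk hP => ?_⟩⟩
    · exact hmem _ _ fun h' => hxy (Point.idx_injective h')
    · rcases F.eq_empty_or_nonempty with rfl | hF
      · exact ⟨⟨0⟩, by simp⟩
      · classical
        -- The points satisfying `P` must end up below the new one and the others above. Two
        -- rationals `a < b` in the gap between their labels give the interval for the task.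
        obtain ⟨a, ha1, ha2⟩ := Order.exists_between_finsets
          (lo := (F.filter P).image fun x => q x.idx)
          (hi := (F.filter fun x => ¬ P x).image fun x => q x.idx) (by
            simp only [Finset.mem_image, Finset.mem_filter]
            rintro _ ⟨x, ⟨hx, hPx⟩, rfl⟩ _ ⟨y, ⟨hy, hPy⟩, rfl⟩
            by_contra hxy
            rcases (not_lt.1 hxy).lt_or_eq with h' | h'
            · exact hPy (hP y hy x hx ((hlt y x).2 h') hPx)
            · have : y = x := Point.idx_injective (hinj h')
              exact hPy (this ▸ hPx))
        obtain ⟨b, hb1, hb2⟩ := Order.exists_between_finsets (lo := {a})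
          (hi := (F.filter fun x => ¬ P x).image fun x => q x.idx) (by
            simpa using ha2)
        have hab : a < b := hb1 a (by simp)
        let A : Finset (ℕ × Δ) := F.attach.image fun x => (x.1.idx, ⟨h x.1, hh x.1 x.2⟩)
        obtain ⟨n, hn1, hn2, hn3⟩ := hgen (A, a, b) (F.sup (fun x => x.idx) + 1) (by
          intro n hn
          refine ⟨by simpa [A] using hF, ?_, ?_, hab⟩
          · intro c hc
            simp only [A, Finset.mem_image, Finset.mem_attach, true_and] at hc
            obtain ⟨x, rfl⟩ := hc
            have : x.1.idx ≤ F.sup (fun x => x.idx) :=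
              Finset.le_sup (f := fun x : Point => x.idx) x.2
            change x.1.idx < n
            omega
          · intro c hc c' hc'
            simp only [A, Finset.mem_image, Finset.mem_attach, true_and] at hc hc'
            obtain ⟨x, rfl⟩ := hc
            obtain ⟨y, rfl⟩ := hc'
            exact hk x.1 x.2 y.1 y.2)
        refine ⟨⟨n⟩, fun x hx => ⟨?_, ?_⟩⟩
        · exact hn1 (x.idx, ⟨h x, hh x hx⟩)
            (Finset.mem_image.2 ⟨⟨x, hx⟩, Finset.mem_attach _ _, rfl⟩)
        · rw [hlt]
          constructor
          · intro hxn
            by_contra hPx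
            exact lt_asymm hxn (hn3.trans (hb2 _ (Finset.mem_image.2
              ⟨x, Finset.mem_filter.2 ⟨hx, hPx⟩, rfl⟩)))
          · intro hPx
            exact (ha1 _ (Finset.mem_image.2
              ⟨x, Finset.mem_filter.2 ⟨hx, hPx⟩, rfl⟩)).trans hn2

open FirstOrder FirstOrder.Language FirstOrder.Language.Structure

/-! ### Ordered `Δ`-metric spaces as structures -/

/-- The structure on `X` is the one of the ordered `Δ`-metric space given by the instances. -/
structure Interprets (Δ : Set ℝ) (X : Type) [(language Δ).Structure X] [MetricSpace X]
    [LinearOrder X] : Prop where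
  dist_mem : ∀ x y : X, x ≠ y → dist x y ∈ Δ
  dist_iff : ∀ (s : Δ) (x y : X), RelMap (distSymb s) ![x, y] ↔ dist x y = s
  lt_iff : ∀ x y : X, RelMap (ltSymb (Δ := Δ)) ![x, y] ↔ x < y

variable {Δ : Set ℝ}

/-- The structure of an ordered metric space. -/
@[reducible]
def structureOfMetric (Δ : Set ℝ) (X : Type) [MetricSpace X] [LinearOrder X] :
    (language Δ).Structure X where
  funMap f := Empty.elim f
  RelMap {n} r := match n, r with
    | _, Rel.dist s => fun x => dist (x 0) (x 1) = s
    | _, Rel.lt => fun x => x 0 < x 1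

theorem interprets_structureOfMetric {X : Type} [MetricSpace X] [LinearOrder X]
    (h : ∀ x y : X, x ≠ y → dist x y ∈ Δ) :
    @Interprets Δ X (structureOfMetric Δ X) _ _ :=
  let := structureOfMetric Δ X
  ⟨h, fun _ _ _ => Iff.rfl, fun _ _ => Iff.rfl⟩

theorem relMap_iff_of_binary {X Y : Type} [(language Δ).Structure X] [(language Δ).Structure Y]
    {f : X → Y}
    (hd : ∀ (s : Δ) (x y : X), RelMap (distSymb s) ![f x, f y] ↔ RelMap (distSymb s) ![x, y])
    (hl : ∀ x y : X, RelMap (ltSymb (Δ := Δ)) ![f x, f y] ↔ RelMap (ltSymb (Δ := Δ)) ![x, y])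
    {n : ℕ} (r : (language Δ).Relations n) (x : Fin n → X) :
    RelMap r (f ∘ x) ↔ RelMap r x := by
  have h2 : ∀ {Z : Type} (z : Fin 2 → Z), z = ![z 0, z 1] := fun z => by
    ext i; fin_cases i <;> rfl
  have hr : ∀ (m : ℕ) (r : Rel Δ m) (x : Fin m → X),
      RelMap (L := language Δ) r (f ∘ x) ↔ RelMap (L := language Δ) r x := by
    intro m r x
    cases r with
    | dist s => rw [h2 (f ∘ x), h2 x]; exact hd s _ _
    | lt => rw [h2 (f ∘ x), h2 x]; exact hl _ _
  exact hr n r x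

theorem Interprets.map_relMap {X Y : Type} [(language Δ).Structure X]
    [(language Δ).Structure Y] {F : Type*} [FunLike F X Y]
    [StrongHomClass (language Δ) F X Y] (f : F)
    (r : (language Δ).Relations 2) (x y : X) :
    RelMap r ![f x, f y] ↔ RelMap r ![x, y] := by
  have h : (f : X → Y) ∘ ![x, y] = ![f x, f y] := by ext i; fin_cases i <;> rfl
  rw [← h]
  exact StrongHomClass.map_rel f r ![x, y]

namespace Interprets

variable {X Y : Type} [(language Δ).Structure X] [MetricSpace X] [LinearOrder X]
  [(language Δ).Structure Y] [MetricSpace Y] [LinearOrder Y]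

theorem isOrderedMetricSpace (h : Interprets Δ X) : IsOrderedMetricSpace Δ X :=
  ⟨inferInstance, inferInstance, h.dist_mem, h.dist_iff, h.lt_iff⟩

theorem distSymb_iff (hX : Interprets Δ X) (hY : Interprets Δ Y) {f : X → Y}
    (hd : ∀ x y, dist (f x) (f y) = dist x y) (s : Δ) (x y : X) :
    RelMap (distSymb s) ![f x, f y] ↔ RelMap (distSymb s) ![x, y] := by
  rw [hX.dist_iff, hY.dist_iff, hd]

theorem ltSymb_iff (hX : Interprets Δ X) (hY : Interprets Δ Y) {f : X → Y}
    (hl : ∀ x y, f x < f y ↔ x < y) (x y : X) :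
    RelMap (ltSymb (Δ := Δ)) ![f x, f y] ↔ RelMap (ltSymb (Δ := Δ)) ![x, y] := by
  rw [hX.lt_iff, hY.lt_iff, hl]

/-- A map preserving distances and order is an embedding of structures. -/
def embedding (hX : Interprets Δ X) (hY : Interprets Δ Y) (f : X → Y)
    (hd : ∀ x y, dist (f x) (f y) = dist x y) (hl : ∀ x y, f x < f y ↔ x < y) :
    X ↪[language Δ] Y where
  toFun := f
  inj' x y h := by rw [← dist_eq_zero, ← hd, h, dist_self]
  map_fun' F := Empty.elim F
  map_rel' r x := relMap_iff_of_binary (hX.distSymb_iff hY hd) (hX.ltSymb_iff hY hl) r x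

/-- A bijection preserving distances and order is an isomorphism of structures. -/
def equiv (hX : Interprets Δ X) (hY : Interprets Δ Y) (f : X ≃ Y)
    (hd : ∀ x y, dist (f x) (f y) = dist x y) (hl : ∀ x y, f x < f y ↔ x < y) :
    X ≃[language Δ] Y where
  toEquiv := f
  map_fun' F := Empty.elim F
  map_rel' r x := relMap_iff_of_binary (hX.distSymb_iff hY hd) (hX.ltSymb_iff hY hl) r x

theorem dist_map (hX : Interprets Δ X) (hY : Interprets Δ Y) {F : Type*} [FunLike F X Y]
    [StrongHomClass (language Δ) F X Y] (f : F) (x y : X) : dist (f x) (f y) = dist x y := by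
  rcases eq_or_ne x y with rfl | hxy
  · simp
  · exact (hY.dist_iff ⟨_, hX.dist_mem x y hxy⟩ _ _).1
      ((map_relMap f _ x y).2 ((hX.dist_iff _ _ _).2 rfl))

theorem lt_map (hX : Interprets Δ X) (hY : Interprets Δ Y) {F : Type*} [FunLike F X Y]
    [StrongHomClass (language Δ) F X Y] (f : F) (x y : X) : f x < f y ↔ x < y := by
  rw [← hX.lt_iff, ← hY.lt_iff, map_relMap]

theorem exists_of_embedding (hY : Interprets Δ Y) {Z : Type} [(language Δ).Structure Z]
    (f : Z ↪[language Δ] Y) :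
    ∃ (_ : MetricSpace Z) (_ : LinearOrder Z), Interprets Δ Z := by
  let : MetricSpace Z := MetricSpace.induced f f.injective inferInstance
  let : LinearOrder Z := LinearOrder.lift' f f.injective
  exact ⟨inferInstance, inferInstance, fun _ _ h => hY.dist_mem _ _ (f.injective.ne h),
    fun s x y => (map_relMap f _ x y).symm.trans (hY.dist_iff s _ _),
    fun x y => (map_relMap f _ x y).symm.trans (hY.lt_iff _ _)⟩

theorem substructure (hX : Interprets Δ X) (S : (language Δ).Substructure X) :
    Interprets Δ S :=
  ⟨fun _ _ h => hX.dist_mem _ _ (Subtype.val_injective.ne h),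
    fun s x y => (map_relMap S.subtype _ x y).symm.trans (hX.dist_iff s _ _),
    fun x y => (map_relMap S.subtype _ x y).symm.trans (hX.lt_iff _ _)⟩

end Interprets

theorem IsOrderedMetricSpace.exists_interprets {X : Type} [(language Δ).Structure X]
    (h : IsOrderedMetricSpace Δ X) :
    ∃ (_ : MetricSpace X) (_ : LinearOrder X), Interprets Δ X := by
  obtain ⟨iM, iL, h1, h2, h3⟩ := h
  exact ⟨iM, iL, h1, h2, h3⟩

/-! ### The extension property characterises the Fraïssé limit -/

/-- An isometric order embedding of a finite subset extends to one more point. -/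
theorem IsUrysohn.exists_extend {U X : Type} [MetricSpace U] [LinearOrder U] [MetricSpace X]
    [LinearOrder X] (hU : IsUrysohn Δ U)
    (hX : ∀ x y : X, x ≠ y → dist x y ∈ Δ)
    (S : Finset X) (f : X → U) (hd : ∀ x ∈ S, ∀ y ∈ S, dist (f x) (f y) = dist x y)
    (hl : ∀ x ∈ S, ∀ y ∈ S, (f x < f y ↔ x < y)) (m : X) (hm : m ∉ S) :
    ∃ z, ∀ x ∈ S, dist z (f x) = dist m x ∧ (f x < z ↔ x < m) := by
  classical
  have : Nonempty X := ⟨m⟩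
  have hinj : ∀ x ∈ S, ∀ y ∈ S, f x = f y → x = y := fun x hx y hy h => by
    rw [← dist_eq_zero, ← hd x hx y hy, h, dist_self]
  choose! g hg using fun (u : U) (hu : u ∈ S.image f) => Finset.mem_image.1 hu
  have hgf : ∀ x ∈ S, g (f x) = x := fun x hx =>
    hinj _ (hg _ (Finset.mem_image_of_mem f hx)).1 _ hx (hg _ (Finset.mem_image_of_mem f hx)).2
  obtain ⟨z, hz⟩ := hU.extension (S.image f) (fun u => dist m (g u)) (fun u => g u < m)
    (by
      rintro u hu
      exact hX _ _ fun h => hm (h ▸ (hg u hu).1))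
    (by
      simp only [Finset.forall_mem_image]
      intro x hx y hy
      rw [hgf x hx, hgf y hy, hd x hx y hy]
      exact ⟨by rw [dist_comm m x, dist_comm m y]; exact abs_dist_sub_le x y m,
        dist_triangle_left x y m⟩)
    (by
      simp only [Finset.forall_mem_image]
      intro x hx y hy hxy
      rw [hgf x hx, hgf y hy]
      exact ((hl x hx y hy).1 hxy).trans)
  refine ⟨z, fun x hx => ?_⟩
  have := hz (f x) (Finset.mem_image_of_mem f hx)
  rwa [hgf x hx] at this

section Limit

variable {U X : Type} [(language Δ).Structure U] [MetricSpace U] [LinearOrder U]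
  [(language Δ).Structure X] [MetricSpace X] [LinearOrder X]

/-- The language is relational, so the substructure generated by `S` and `m` only adds the point
`m`, and a single use of the extension property suffices. -/
theorem IsUrysohn.isExtensionPair (hU : IsUrysohn Δ U) (iU : Interprets Δ U)
    (iX : Interprets Δ X) : (language Δ).IsExtensionPair X U := by
  classical
  rw [isExtensionPair_iff_exists_embedding_closure_singleton_sup]
  intro S hS f m
  have hfin : (S : Set X).Finite := hS.finite
  have hmem : ∀ x, x ∈ Substructure.closure (language Δ) {m} ⊔ S ↔ x = m ∨ x ∈ S := fun x => by
    have h : Substructure.closure (language Δ) {m} ⊔ S =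
        Substructure.closure (language Δ) (insert m (S : Set X)) := by
      rw [Substructure.closure_insert, Substructure.closure_eq]
    rw [h, ← SetLike.mem_coe, Substructure.closure_eq_of_isRelational]
    rfl
  by_cases hm : m ∈ S
  · have hle : Substructure.closure (language Δ) {m} ⊔ S ≤ S := fun x hx => by
      rcases (hmem x).1 hx with rfl | h
      exacts [hm, h]
    exact ⟨f.comp (Substructure.inclusion hle), by ext; rfl⟩
  · have iS := iX.substructure S
    -- A default value making the partial map total; it plays no role outside `S`.
    obtain ⟨u, -⟩ := hU.extension ∅ (fun _ => 0) (fun _ => True) (by simp) (by simp) (by simp)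
    let f' : X → U := fun x => if h : x ∈ S then f ⟨x, h⟩ else u
    have hf' : ∀ x (h : x ∈ S), f' x = f ⟨x, h⟩ := fun x h => dif_pos h
    obtain ⟨z, hz⟩ := hU.exists_extend iX.dist_mem hfin.toFinset f'
      (by
        simp only [Set.Finite.mem_toFinset, SetLike.mem_coe]
        intro x hx y hy
        rw [hf' x hx, hf' y hy]
        exact iS.dist_map iU f _ _)
      (by
        simp only [Set.Finite.mem_toFinset, SetLike.mem_coe]
        intro x hx y hy
        rw [hf' x hx, hf' y hy]
        exact iS.lt_map iU f _ _) m (by simpa using hm)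
    simp only [Set.Finite.mem_toFinset, SetLike.mem_coe] at hz
    let g : ↥(Substructure.closure (language Δ) {m} ⊔ S) → U :=
      fun x => if h : (x : X) ∈ S then f ⟨x, h⟩ else z
    have hgS : ∀ (x : ↥(Substructure.closure (language Δ) {m} ⊔ S)) (h : (x : X) ∈ S),
        g x = f ⟨x, h⟩ := fun x h => dif_pos h
    have hgz : ∀ x : ↥(Substructure.closure (language Δ) {m} ⊔ S), (x : X) ∉ S → g x = z :=
      fun x h => dif_neg h
    have hm' : ∀ x : ↥(Substructure.closure (language Δ) {m} ⊔ S), (x : X) ∉ S → (x : X) = m :=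
      fun x h => ((hmem x).1 x.2).resolve_right h
    refine ⟨(iX.substructure _).embedding iU g ?_ ?_, ?_⟩
    · intro x y
      rw [Subtype.dist_eq]
      by_cases hx : (x : X) ∈ S <;> by_cases hy : (y : X) ∈ S
      · rw [hgS x hx, hgS y hy]; exact iS.dist_map iU f _ _
      · rw [hgS x hx, hgz y hy, hm' y hy, dist_comm, ← hf' x hx, (hz x hx).1, dist_comm]
      · rw [hgS y hy, hgz x hx, hm' x hx, ← hf' y hy, (hz y hy).1]
      · rw [hgz x hx, hgz y hy, hm' x hx, hm' y hy, dist_self, dist_self]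
    · intro x y
      rw [← Subtype.coe_lt_coe]
      by_cases hx : (x : X) ∈ S <;> by_cases hy : (y : X) ∈ S
      · rw [hgS x hx, hgS y hy]; exact iS.lt_map iU f _ _
      · rw [hgS x hx, hgz y hy, hm' y hy, ← hf' x hx, (hz x hx).2]
      · have hne : f' y ≠ z := fun h => by
          have := (hz y hy).1
          rw [h, dist_self, eq_comm, dist_eq_zero] at this
          exact hm (this ▸ hy)
        have hne' : (y : X) ≠ m := fun h => hm (h ▸ hy)
        rw [hgS y hy, hgz x hx, hm' x hx, ← hf' y hy, ← not_le, ← not_le, not_iff_not,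
          hne.le_iff_lt, hne'.le_iff_lt, (hz y hy).2]
      · rw [hgz x hx, hgz y hy, hm' x hx, hm' y hy, lt_self_iff_false, lt_self_iff_false]
    · ext x
      exact (hgS (Substructure.inclusion le_sup_right x) x.2).symm

/-- Without nullary symbols the empty map is a partial isomorphism; this is the `default` from which
the embedding of a finite space is grown below. -/
instance : IsEmpty ((language Δ).Relations 0) := ⟨fun r => nomatch (r : Rel Δ 0)⟩

theorem IsUrysohn.isFraisseLimit [Countable U] (hU : IsUrysohn Δ U) (iU : Interprets Δ U) :
    IsFraisseLimit (finiteOrderedMetricSpaces Δ) U where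
  ultrahomogeneous :=
    (isUltrahomogeneous_iff_IsExtensionPair cg_of_countable).2 (hU.isExtensionPair iU iU)
  age := by
    ext N
    constructor
    · rintro ⟨hN, ⟨f⟩⟩
      obtain ⟨iM, iL, h⟩ := iU.exists_of_embedding f
      exact ⟨hN.finite, h.isOrderedMetricSpace⟩
    · rintro ⟨hN, h⟩
      obtain ⟨iM, iL, iN⟩ := h.exists_interprets
      obtain ⟨f, -⟩ := embedding_from_cg cg_of_countable default (hU.isExtensionPair iU iN)
      exact ⟨FG.of_finite, ⟨f⟩⟩

end Limit

theorem exists_isOrderedUrysohnSpace (hΔ : IsDistanceValueSet Δ) (hc : Δ.Countable) :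
    ∃ (U : Type) (_ : (language Δ).Structure U), IsOrderedUrysohnSpace Δ U := by
  obtain ⟨U, iC, iM, iL, hU⟩ := exists_isUrysohn hΔ hc
  let := structureOfMetric Δ U
  exact ⟨U, inferInstance, iC, hU.isFraisseLimit (interprets_structureOfMetric hU.dist_mem)⟩

theorem IsUrysohn.of_isometry {U V : Type} [MetricSpace U] [LinearOrder U] [MetricSpace V]
    [LinearOrder V] (hU : IsUrysohn Δ U) (e : V ≃ U) (hd : ∀ x y, dist (e x) (e y) = dist x y)
    (hl : ∀ x y, e x < e y ↔ x < y) : IsUrysohn Δ V where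
  dist_mem x y h := hd x y ▸ hU.dist_mem _ _ (e.injective.ne h)
  extension F h P hh hk hP := by
    classical
    obtain ⟨z, hz⟩ := hU.extension (F.image e) (h ∘ e.symm) (P ∘ e.symm)
      (by simpa only [Finset.forall_mem_image, Function.comp_apply, e.symm_apply_apply] using hh)
      (by simpa only [Finset.forall_mem_image, Function.comp_apply, e.symm_apply_apply, hd]
        using hk)
      (by simpa only [Finset.forall_mem_image, Function.comp_apply, e.symm_apply_apply, hl]
        using hP)
    refine ⟨e.symm z, fun x hx => ?_⟩
    rw [← hd, ← hl, e.apply_symm_apply]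
    simpa using hz (e x) (Finset.mem_image_of_mem e hx)

/-- Every ordered `Δ`-Urysohn space is a space with the extension property. -/
theorem IsOrderedUrysohnSpace.exists_isUrysohn {U : Type} [(language Δ).Structure U]
    (h : IsOrderedUrysohnSpace Δ U) (hΔ : IsDistanceValueSet Δ) (hc : Δ.Countable) :
    ∃ (_ : MetricSpace U) (_ : LinearOrder U), Interprets Δ U ∧ IsUrysohn Δ U := by
  obtain ⟨iC, hU⟩ := h
  obtain ⟨V, iCV, iM, iL, hV⟩ := OrderedUrysohn.exists_isUrysohn hΔ hc
  let := structureOfMetric Δ V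
  have iV : Interprets Δ V := interprets_structureOfMetric hV.dist_mem
  -- Uniqueness of the Fraïssé limit allows the metric and the order to be pulled back from the
  -- constructed space.
  obtain ⟨e⟩ := hU.nonempty_equiv (hV.isFraisseLimit iV)
  let : MetricSpace U := MetricSpace.induced e e.injective inferInstance
  let : LinearOrder U := LinearOrder.lift' e e.injective
  exact ⟨inferInstance, inferInstance,
    ⟨fun x y h => hV.dist_mem _ _ (e.injective.ne h),
      fun s x y => (Interprets.map_relMap e _ x y).symm.trans (iV.dist_iff s _ _),
      fun x y => (Interprets.map_relMap e _ x y).symm.trans (iV.lt_iff _ _)⟩,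
    hV.of_isometry e.toEquiv (fun _ _ => rfl) (fun _ _ => Iff.rfl)⟩

/-! ### Topological groups whose open subgroups are stabilisers of finite sets -/

/-- Properties of a permutation group which make the points recoverable from the topological
group, as the maximal open subgroups. -/
structure IsReconstructible (G U : Type*) [Group G] [TopologicalSpace G] [MulAction G U] :
    Prop where
  isOpen_stabilizer : ∀ a : U, IsOpen (MulAction.stabilizer G a : Set G)
  exists_fixingSubgroup_le : ∀ K : Subgroup G, IsOpen (K : Set G) →
    ∃ F : Finset U, fixingSubgroup G (F : Set U) ≤ K
  smul_eq_of_maps : ∀ (F : Finset U) (g : G), (∀ x ∈ F, g • x ∈ F) → ∀ x ∈ F, g • x = x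
  eq_or_eq : ∀ (C : Finset U) (a : U), a ∉ C → ∀ K : Subgroup G,
    fixingSubgroup G (insert a (C : Set U)) ≤ K → K ≤ fixingSubgroup G (C : Set U) →
    K = fixingSubgroup G (insert a (C : Set U)) ∨ K = fixingSubgroup G (C : Set U)
  exists_smul_ne : ∀ (B : Finset U) (a : U), a ∉ B →
    ∃ g ∈ fixingSubgroup G (B : Set U), g • a ≠ a

namespace IsReconstructible

variable {G U H V : Type*} [Group G] [TopologicalSpace G] [MulAction G U]
  [Group H] [TopologicalSpace H] [MulAction H V]

/-- Take a finite `A` of least size whose pointwise stabiliser lies in `K`. If `K` preserves `A`,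
rigidity makes it fix `A` pointwise. Otherwise some `g ∈ K` moves a point `a` of `A` out of `A`, and
`eq_or_eq` shows that either `a` can be dropped from `A` or `K` has an element fixing the rest of
`A` but moving `a`; both are impossible or contradictory as arranged below. -/
theorem exists_eq_fixingSubgroup (h : IsReconstructible G U) {K : Subgroup G}
    (hK : IsOpen (K : Set G)) : ∃ A : Finset U, K = fixingSubgroup G (A : Set U) := by
  classical
  have hex : ∃ n, ∃ A : Finset U, A.card = n ∧ fixingSubgroup G (A : Set U) ≤ K := by
    obtain ⟨F, hF⟩ := h.exists_fixingSubgroup_le K hK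
    exact ⟨_, F, rfl, hF⟩
  obtain ⟨A, hA, hAK⟩ := Nat.find_spec hex
  have hmin : ∀ B : Finset U, fixingSubgroup G (B : Set U) ≤ K → A.card ≤ B.card := fun B hB => by
    rw [hA]
    exact Nat.find_min' hex ⟨B, rfl, hB⟩
  refine ⟨A, le_antisymm (fun g hg => ?_) hAK⟩
  rw [mem_fixingSubgroup_iff]
  refine h.smul_eq_of_maps A g fun a ha => ?_
  by_contra hga
  set B : Finset U := A.image fun x => g⁻¹ • x with hB
  have haB : a ∉ B := by
    simp only [hB, Finset.mem_image, not_exists, not_and]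
    rintro x hx rfl
    exact hga (by simpa using hx)
  -- The stabiliser of `g⁻¹ A` is the conjugate by `g⁻¹ ∈ K` of that of `A`.
  have hBK : fixingSubgroup G (B : Set U) ≤ K := fun k hk => by
    have : g * k * g⁻¹ ∈ K := hAK (by
      rw [mem_fixingSubgroup_iff] at hk ⊢
      intro x hx
      have := hk (g⁻¹ • x) (by
        simp only [hB, Finset.coe_image]
        exact ⟨x, hx, rfl⟩)
      rw [mul_smul, mul_smul, this, smul_inv_smul])
    have := K.mul_mem (K.mul_mem (K.inv_mem hg) this) hg
    simpa [mul_assoc] using this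
  set C := A.erase a with hC
  have hAC : insert a (C : Set U) = A := by
    rw [hC, ← Finset.coe_insert, Finset.insert_erase ha]
  have haC : a ∉ C := Finset.notMem_erase a A
  rcases h.eq_or_eq C a haC (K ⊓ fixingSubgroup G (C : Set U))
    (le_inf (hAC ▸ hAK) (fixingSubgroup_antitone G U (Set.subset_insert _ _))) inf_le_right
    with h1 | h1
  -- Such a `k` lies in `K` because it fixes `B`, and it fixes `C`, so by `h1` it would have to fix
  -- `a`.
  · obtain ⟨k, hk, hka⟩ := h.exists_smul_ne (B ∪ C) a (by simp [haB, haC])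
    rw [mem_fixingSubgroup_iff] at hk
    have hk' : k ∈ K ⊓ fixingSubgroup G (C : Set U) := by
      refine ⟨hBK ?_, ?_⟩
      · rw [mem_fixingSubgroup_iff]
        exact fun x hx => hk x (by simp only [Finset.coe_union]; exact Or.inl hx)
      · change k ∈ fixingSubgroup G (C : Set U)
        rw [mem_fixingSubgroup_iff]
        exact fun x hx => hk x (by simp only [Finset.coe_union]; exact Or.inr hx)
    rw [h1, mem_fixingSubgroup_iff] at hk'
    exact hka (hk' a (Set.mem_insert _ _))
  · have := hmin C (inf_eq_right.1 h1)
    exact absurd this (Finset.card_erase_lt_of_mem ha).not_ge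

theorem stabilizer_ne_top (h : IsReconstructible G U) (a : U) : MulAction.stabilizer G a ≠ ⊤ := by
  intro h'
  obtain ⟨g, -, hg⟩ := h.exists_smul_ne ∅ a (by simp)
  exact hg (MulAction.mem_stabilizer_iff.1 (h' ▸ Subgroup.mem_top g))

theorem eq_stabilizer_or_eq_top (h : IsReconstructible G U) {a : U} {K : Subgroup G}
    (hK : MulAction.stabilizer G a ≤ K) : K = MulAction.stabilizer G a ∨ K = ⊤ := by
  have h1 : fixingSubgroup G (insert a ((∅ : Finset U) : Set U)) = MulAction.stabilizer G a := by
    ext g; simp [mem_fixingSubgroup_iff]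
  have h2 : fixingSubgroup G ((∅ : Finset U) : Set U) = ⊤ := by
    ext g; simp
  have := h.eq_or_eq ∅ a (by simp) K
  rw [h1, h2] at this
  exact this hK le_top

theorem eq_of_stabilizer (h : IsReconstructible G U) {a b : U}
    (hab : ∀ g : G, g • a = a → g • b = b) : b = a := by
  by_contra hne
  obtain ⟨g, hg, hgb⟩ := h.exists_smul_ne {a} b (by simpa using hne)
  exact hgb (hab g ((mem_fixingSubgroup_iff G).1 hg a (by simp)))

/-- The image of the stabiliser of `a` is open and proper, hence the stabiliser of a nonempty finite
set. It lies in the stabiliser of any point `b` of that set, and maximality forces equality. -/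
theorem exists_point (hG : IsReconstructible G U) (hH : IsReconstructible H V) (φ : G ≃ₜ* H)
    (a : U) : ∃ b : V, ∀ g : G, φ g • b = b ↔ g • a = a := by
  set K : Subgroup H := (MulAction.stabilizer G a).comap (φ.symm : H →* G) with hK
  have hKo : IsOpen (K : Set H) := (hG.isOpen_stabilizer a).preimage φ.symm.continuous
  have hKmem : ∀ k : H, k ∈ K ↔ φ.symm k • a = a := fun k => Iff.rfl
  obtain ⟨B, hB⟩ := hH.exists_eq_fixingSubgroup hKo
  rcases B.eq_empty_or_nonempty with rfl | ⟨b, hb⟩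
  · refine absurd ?_ (hG.stabilizer_ne_top a)
    rw [eq_top_iff]
    intro g _
    have : φ g ∈ K := by rw [hB]; simp
    simpa [hKmem] using this
  · have hle : MulAction.stabilizer G a ≤ (MulAction.stabilizer H b).comap (φ : G →* H) := by
      intro g hg
      have : φ g ∈ K := by simpa [hKmem] using hg
      rw [hB, mem_fixingSubgroup_iff] at this
      exact this b hb
    rcases hG.eq_stabilizer_or_eq_top hle with h | h
    · exact ⟨b, fun g => SetLike.ext_iff.1 h g⟩
    · refine absurd ?_ (hH.stabilizer_ne_top b)
      rw [eq_top_iff]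
      intro k _
      have : φ.symm k ∈ (MulAction.stabilizer H b).comap (φ : G →* H) := h ▸ Subgroup.mem_top _
      simpa using this

/-- An isomorphism of topological groups is induced by a bijection of the points. -/
theorem exists_equiv (hG : IsReconstructible G U) (hH : IsReconstructible H V) (φ : G ≃ₜ* H) :
    ∃ β : U ≃ V, ∀ (g : G) (a : U), β (g • a) = φ g • β a := by
  choose β hβ using hG.exists_point hH φ
  choose γ hγ using hH.exists_point hG φ.symm
  refine ⟨⟨β, γ, fun a => ?_, fun b => ?_⟩, fun g a => ?_⟩
  · refine hG.eq_of_stabilizer fun g hg => ?_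
    have := hγ (β a) (φ g)
    rw [φ.symm_apply_apply, hβ] at this
    exact this.2 hg
  · refine hH.eq_of_stabilizer fun k hk => ?_
    have := hβ (γ b) (φ.symm k)
    rw [φ.apply_symm_apply, hγ] at this
    exact this.2 hk
  · change β (g • a) = φ g • β a
    -- Points are determined by their stabilisers, and the stabiliser of a translate is a conjugate.
    refine hH.eq_of_stabilizer fun k hk => ?_
    obtain ⟨k, rfl⟩ := φ.surjective k
    have h1 : φ (g⁻¹ * k * g) • β a = β a := by
      rw [map_mul, map_mul, map_inv, mul_smul, mul_smul, hk, inv_smul_smul]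
    rw [hβ, mul_smul, mul_smul, inv_smul_eq_iff] at h1
    exact (hβ _ _).2 h1

end IsReconstructible

/-! ### The action of the automorphism group -/

namespace Aut

variable {L : FirstOrder.Language.{0, 0}} {M : Type} [L.Structure M]

instance : MulAction (Aut L M) M where
  smul g x := g.toFun x
  one_smul _ := rfl
  mul_smul _ _ _ := rfl

theorem continuous_smul (x : M) :
    @Continuous (Aut L M) M _ ⊥ fun g => g • x :=
  letI : TopologicalSpace M := ⊥
  (continuous_apply x).comp continuous_induced_dom

theorem continuous_iff {X : Type*} [TopologicalSpace X] {f : X → Aut L M} :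
    Continuous f ↔ ∀ x, @Continuous X M _ ⊥ fun a => f a • x := by
  let : TopologicalSpace M := ⊥
  exact continuous_induced_rng.trans continuous_pi_iff

theorem isOpen_stabilizer (x : M) : IsOpen (MulAction.stabilizer (Aut L M) x : Set (Aut L M)) := by
  let : TopologicalSpace M := ⊥
  have : DiscreteTopology M := ⟨rfl⟩
  exact (isOpen_discrete {x}).preimage (continuous_smul x)

theorem exists_fixingSubgroup_le (K : Subgroup (Aut L M)) (hK : IsOpen (K : Set (Aut L M))) :
    ∃ F : Finset M, fixingSubgroup (Aut L M) (F : Set M) ≤ K := by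
  let : TopologicalSpace M := ⊥
  have : DiscreteTopology M := ⟨rfl⟩
  obtain ⟨O, hO, hOK⟩ := isOpen_induced_iff.1 hK
  have h1 : (1 : Aut L M).toFun ∈ O := by
    have : (1 : Aut L M) ∈ toFun ⁻¹' O := by rw [hOK]; exact K.one_mem
    exact this
  obtain ⟨F, u, hu, huO⟩ := isOpen_pi_iff.1 hO _ h1
  refine ⟨F, fun g hg => ?_⟩
  rw [mem_fixingSubgroup_iff] at hg
  rw [← SetLike.mem_coe, ← hOK]
  refine huO fun x hx => ?_
  have : g.toFun x = (1 : Aut L M).toFun x := hg x hx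
  rw [this]
  exact (hu x hx).2

end Aut

section Action

variable {Δ : Set ℝ} {U : Type} [(language Δ).Structure U] [MetricSpace U] [LinearOrder U]

theorem Interprets.dist_smul (iU : Interprets Δ U) (g : Aut (language Δ) U) (x y : U) :
    dist (g • x) (g • y) = dist x y :=
  iU.dist_map iU (F := U ≃[language Δ] U) g x y

theorem Interprets.smul_lt_smul (iU : Interprets Δ U) (g : Aut (language Δ) U) (x y : U) :
    g • x < g • y ↔ x < y :=
  iU.lt_map iU (F := U ≃[language Δ] U) g x y

/-- A strictly increasing self-map of a finite chain is the identity. This is where the order is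
indispensable. -/
theorem Interprets.smul_eq_of_maps (iU : Interprets Δ U) (F : Finset U) (g : Aut (language Δ) U)
    (h : ∀ x ∈ F, g • x ∈ F) : ∀ x ∈ F, g • x = x := by
  have hmono : StrictMono fun x : F => (⟨g • (x : U), h x x.2⟩ : F) := fun x y hxy =>
    (iU.smul_lt_smul g x y).2 hxy
  exact fun x hx => congrArg Subtype.val (congrFun hmono.eq_id ⟨x, hx⟩)

theorem IsUrysohn.exists_aut [Countable U] (hU : IsUrysohn Δ U) (iU : Interprets Δ U)
    (F : Finset U) (f : U → U) (hd : ∀ x ∈ F, ∀ y ∈ F, dist (f x) (f y) = dist x y)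
    (hl : ∀ x ∈ F, ∀ y ∈ F, (f x < f y ↔ x < y)) :
    ∃ g : Aut (language Δ) U, ∀ x ∈ F, g • x = f x := by
  set S := Substructure.closure (language Δ) (F : Set U)
  have hS : ∀ x, x ∈ S ↔ x ∈ F := fun x => by
    rw [← SetLike.mem_coe, Substructure.closure_eq_of_isRelational]; rfl
  obtain ⟨g, hg⟩ := (hU.isFraisseLimit iU).ultrahomogeneous S
    (Substructure.fg_closure F.finite_toSet)
    ((iU.substructure S).embedding iU (fun x => f x)
      (fun x y => hd x ((hS x).1 x.2) y ((hS y).1 y.2))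
      (fun x y => hl x ((hS x).1 x.2) y ((hS y).1 y.2)))
  exact ⟨g, fun x hx => (congrArg (fun k => k ⟨x, (hS x).2 hx⟩) hg).symm⟩

-- The bound `r ≤ 2 * dist a c` is what the triangle inequality between `a`, `c` and the new point
-- demands; `dist a x ≤ 2 * r` does the same for `a` and `x`. The case `x = a` is allowed and serves
-- `exists_smul_ne`.
omit [(language Δ).Structure U] in
theorem IsUrysohn.exists_midpoint (hU : IsUrysohn Δ U) (C : Finset U) {a x : U} (ha : a ∉ C)
    (hd : ∀ c ∈ C, dist x c = dist a c) {r : ℝ} (hr : r ∈ Δ) (hr0 : 0 < r)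
    (hrC : ∀ c ∈ C, r ≤ 2 * dist a c) (hax : dist a x ≤ 2 * r) :
    ∃ z, dist z a = r ∧ dist z x = r ∧ ∀ c ∈ C, dist z c = dist a c ∧ (c < z ↔ c < a) := by
  classical
  have hCa : ∀ c ∈ C, c ≠ a := fun c hc h => ha (h ▸ hc)
  have hCx : ∀ c ∈ C, c ≠ x := fun c hc h => by
    have := hd c hc
    rw [h, dist_self, eq_comm, dist_eq_zero] at this
    exact ha (this ▸ h ▸ hc)
  let h : U → ℝ := fun u => if u = a ∨ u = x then r else dist a u
  have hha : h a = r := if_pos (Or.inl rfl)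
  have hhx : h x = r := if_pos (Or.inr rfl)
  have hhC : ∀ c ∈ C, h c = dist a c := fun c hc =>
    if_neg (not_or.2 ⟨hCa c hc, hCx c hc⟩)
  obtain ⟨z, hz⟩ := hU.extension (insert a (insert x C)) h (fun u => u ≤ a)
    (by
      simp only [Finset.forall_mem_insert, hha, hhx]
      refine ⟨hr, hr, fun c hc => ?_⟩
      rw [hhC c hc]
      exact hU.dist_mem _ _ (hCa c hc).symm)
    (by
      have key : ∀ c ∈ C, |r - dist a c| ≤ dist a c ∧ dist a c ≤ r + dist a c := fun c hc =>
        ⟨abs_le.2 ⟨by linarith, by linarith [hrC c hc]⟩, by linarith⟩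
      have key' : ∀ c ∈ C, |dist a c - r| ≤ dist a c ∧ dist a c ≤ dist a c + r := fun c hc => by
        rw [abs_sub_comm, add_comm]; exact key c hc
      have key2 : |r - r| ≤ dist a x ∧ dist a x ≤ r + r := by
        rw [sub_self, abs_zero]; exact ⟨dist_nonneg, by linarith⟩
      have key0 : ∀ u : U, |r - r| ≤ dist u u ∧ dist u u ≤ r + r := fun u => by
        rw [sub_self, abs_zero, dist_self]; exact ⟨le_rfl, by linarith⟩
      have hd' : ∀ c ∈ C, dist c x = dist a c := fun c hc => by rw [dist_comm, hd c hc]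
      simp only [Finset.forall_mem_insert, hha, hhx]
      refine ⟨⟨key0 a, key2, fun c hc => ?_⟩, ⟨dist_comm a x ▸ key2, key0 x, fun c hc => ?_⟩,
        fun c hc => ⟨?_, ?_, fun c' hc' => ?_⟩⟩
      · rw [hhC c hc]; exact key c hc
      · rw [hhC c hc, hd c hc]; exact key c hc
      · rw [hhC c hc, dist_comm c a]; exact key' c hc
      · rw [hhC c hc, hd' c hc]; exact key' c hc
      · rw [hhC c hc, hhC c' hc']
        refine ⟨?_, dist_triangle_left c c' a⟩
        rw [dist_comm a c, dist_comm a c']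
        exact abs_dist_sub_le c c' a)
    (fun x _ y _ hxy hy => (hxy.trans_le hy).le)
  refine ⟨z, (hz a (by simp)).1.trans hha, (hz x (by simp)).1.trans hhx, fun c hc => ?_⟩
  have := hz c (by simp [hc])
  exact ⟨this.1.trans (hhC c hc), this.2.trans (hCa c hc).le_iff_lt⟩

theorem IsUrysohn.exists_aut_fixing [Countable U] (hU : IsUrysohn Δ U) (iU : Interprets Δ U)
    (C : Finset U) {a x : U} (ha : a ∉ C)
    (hd : ∀ c ∈ C, dist x c = dist a c) (hl : ∀ c ∈ C, (c < x ↔ c < a)) :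
    ∃ g ∈ fixingSubgroup (Aut (language Δ) U) (C : Set U), g • a = x := by
  classical
  have hCa : ∀ c ∈ C, c ≠ a := fun c hc h => ha (h ▸ hc)
  have hCx : ∀ c ∈ C, c ≠ x := fun c hc h => by
    have := hd c hc
    rw [h, dist_self, eq_comm, dist_eq_zero] at this
    exact ha (this ▸ h ▸ hc)
  have hl' : ∀ c ∈ C, (x < c ↔ a < c) := fun c hc => by
    rw [← not_le, ← not_le, (hCa c hc).le_iff_lt, (hCx c hc).le_iff_lt, hl c hc]
  let f : U → U := fun u => if u = a then x else u
  have hfa : f a = x := if_pos rfl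
  have hfC : ∀ c ∈ C, f c = c := fun c hc => if_neg (hCa c hc)
  obtain ⟨g, hg⟩ := hU.exists_aut iU (insert a C) f
    (by
      simp only [Finset.forall_mem_insert, hfa, dist_self, true_and]
      refine ⟨fun c hc => ?_, fun c hc => ⟨?_, fun c' hc' => ?_⟩⟩
      · rw [hfC c hc, hd c hc]
      · rw [hfC c hc, dist_comm, hd c hc, dist_comm]
      · rw [hfC c hc, hfC c' hc'])
    (by
      simp only [Finset.forall_mem_insert, hfa, lt_self_iff_false, true_and]
      refine ⟨fun c hc => ?_, fun c hc => ⟨?_, fun c' hc' => ?_⟩⟩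
      · rw [hfC c hc, hl' c hc]
      · rw [hfC c hc, hl c hc]
      · rw [hfC c hc, hfC c' hc'])
  refine ⟨g, ?_, by rw [hg a (by simp), hfa]⟩
  rw [mem_fixingSubgroup_iff]
  exact fun c hc => (hg c (Finset.mem_insert_of_mem hc)).trans (hfC c hc)

theorem IsUrysohn.exists_smul_ne [Countable U] (hU : IsUrysohn Δ U) (iU : Interprets Δ U)
    (hΔ : IsDistanceValueSet Δ) (hne : Δ.Nonempty) (B : Finset U) (a : U) (ha : a ∉ B) :
    ∃ g ∈ fixingSubgroup (Aut (language Δ) U) (B : Set U), g • a ≠ a := by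
  -- The least distance from `a` to `B` is small enough for a second realisation of the type of `a`
  -- at that distance from `a`.
  obtain ⟨r, hr, hrB⟩ : ∃ r ∈ Δ, ∀ b ∈ B, r ≤ 2 * dist a b := by
    rcases B.eq_empty_or_nonempty with rfl | hB
    · obtain ⟨r, hr⟩ := hne
      exact ⟨r, hr, by simp⟩
    · obtain ⟨b, hb, hmin⟩ := B.exists_min_image (dist a) hB
      refine ⟨dist a b, hU.dist_mem _ _ fun h => ha (h ▸ hb), fun c hc => ?_⟩
      linarith [hmin c hc, dist_nonneg (x := a) (y := c)]
  have hr0 := hΔ.pos r hr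
  obtain ⟨z, hz1, -, hz2⟩ := hU.exists_midpoint B ha (fun _ _ => rfl) hr hr0 hrB
    (by rw [dist_self]; linarith)
  obtain ⟨g, hg, rfl⟩ := hU.exists_aut_fixing iU B ha (fun c hc => (hz2 c hc).1)
    (fun c hc => (hz2 c hc).2)
  refine ⟨g, hg, fun h => ?_⟩
  rw [h, dist_self] at hz1
  exact hr0.ne hz1

/-- A subgroup strictly above the stabiliser of `insert a C` and fixing `C` is transitive on the
realisations of the type of `a` over `C`. -/
theorem IsUrysohn.exists_mem_smul_eq [Countable U] (hU : IsUrysohn Δ U) (iU : Interprets Δ U)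
    (hΔ : IsDistanceValueSet Δ) (C : Finset U) (a : U) (ha : a ∉ C)
    (K : Subgroup (Aut (language Δ) U))
    (h1 : fixingSubgroup (Aut (language Δ) U) (insert a (C : Set U)) ≤ K)
    (h2 : K ≤ fixingSubgroup (Aut (language Δ) U) (C : Set U))
    {g : Aut (language Δ) U} (hg : g ∈ K) (hga : g • a ≠ a) {x : U}
    (hd : ∀ c ∈ C, dist x c = dist a c) (hl : ∀ c ∈ C, (c < x ↔ c < a)) :
    ∃ k ∈ K, k • a = x := by
  classical
  -- `D` is the set of realisations of the type of `a` over `C`, and `S` is the `K`-orbit of `a`;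
  -- the aim is `D ⊆ S`.
  let D : Set U := {x | ∀ c ∈ C, dist x c = dist a c ∧ (c < x ↔ c < a)}
  let S : Set U := {x | ∃ k ∈ K, k • a = x}
  have hDsmul : ∀ k ∈ K, ∀ x ∈ D, k • x ∈ D := fun k hk x hx c hc => by
    have hkc : k • c = c := (mem_fixingSubgroup_iff _).1 (h2 hk) c hc
    have h3 := iU.dist_smul k x c
    have h4 := iU.smul_lt_smul k c x
    rw [hkc] at h3 h4
    exact ⟨h3.trans (hx c hc).1, h4.trans (hx c hc).2⟩
  have haD : a ∈ D := fun c _ => ⟨rfl, Iff.rfl⟩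
  have hSD : ∀ y ∈ S, y ∈ D := by
    rintro _ ⟨k, hk, rfl⟩
    exact hDsmul k hk a haD
  have hDC : ∀ y ∈ D, y ∉ C := fun y hy hyC => by
    have := (hy y hyC).1
    rw [dist_self, eq_comm, dist_eq_zero] at this
    exact ha (this ▸ hyC)
  set r := dist a (g • a) with hr
  have hrΔ : r ∈ Δ := hU.dist_mem _ _ hga.symm
  have hr0 : 0 < r := hΔ.pos _ hrΔ
  have hrC : ∀ y ∈ D, ∀ c ∈ C, r ≤ 2 * dist y c := fun y hy c hc => by
    have h3 := dist_triangle_right a (g • a) c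
    rw [(hDsmul g hg a haD c hc).1] at h3
    rw [(hy c hc).1]
    linarith
  -- points at distance `r` from `a` on a given side
  have hside : ∀ b ∈ S, ∀ x ∈ D, dist a b = dist a x → (a < b ↔ a < x) → b ≠ a → x ≠ a →
      x ∈ S := by
    rintro _ ⟨k, hk, rfl⟩ x hx hdx hlx hb hxa
    have hkD := hDsmul k hk a haD
    obtain ⟨m, hm, hmx⟩ := hU.exists_aut_fixing iU (insert a C) (a := k • a) (x := x)
      (by simp [hb, hDC _ hkD])
      (by
        simp only [Finset.forall_mem_insert]
        refine ⟨by rw [dist_comm, ← hdx, dist_comm], fun c hc => ?_⟩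
        rw [(hx c hc).1, (hkD c hc).1])
      (by
        simp only [Finset.forall_mem_insert]
        refine ⟨hlx.symm, fun c hc => ?_⟩
        rw [(hx c hc).2, (hkD c hc).2])
    rw [Finset.coe_insert] at hm
    exact ⟨m * k, K.mul_mem (h1 hm) hk, by rw [mul_smul, hmx]⟩
  have hstep0 : ∀ x ∈ D, dist a x = r → x ∈ S := fun x hx hdx => by
    have hxa : x ≠ a := fun h => by
      rw [h, dist_self] at hdx
      exact hr0.ne hdx
    by_cases hlx : a < g • a ↔ a < x
    · exact hside _ ⟨g, hg, rfl⟩ x hx hdx.symm hlx hga hxa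
    -- The points `g • a` and `g⁻¹ • a` are equally far from `a` but on opposite sides, so both
    -- sides are covered.
    · have hg' : g⁻¹ • a ≠ a := fun h => hga (by rw [eq_comm, ← inv_smul_eq_iff, h])
      refine hside _ ⟨g⁻¹, K.inv_mem hg, rfl⟩ x hx ?_ ?_ hg' hxa
      · rw [hdx, ← iU.dist_smul g, smul_inv_smul, dist_comm]
      · rw [← iU.smul_lt_smul g, smul_inv_smul]
        rcases lt_or_gt_of_ne hga with h | h <;> rcases lt_or_gt_of_ne hxa with h' | h' <;>
          simp_all [h.not_gt, h'.not_gt]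
  have hstep : ∀ y ∈ S, ∀ x ∈ D, dist y x = r → x ∈ S := by
    rintro _ ⟨k, hk, rfl⟩ x hx hdx
    obtain ⟨m, hm, hmx⟩ := hstep0 (k⁻¹ • x) (hDsmul _ (K.inv_mem hk) x hx)
      (by rw [← iU.dist_smul k, smul_inv_smul, hdx])
    exact ⟨k * m, K.mul_mem hk hm, by rw [mul_smul, hmx, smul_inv_smul]⟩
  -- Induction by doubling: a point of `D` at distance `2 ^ n * r` from both `y` and `x` splits the
  -- move into two shorter ones. That distance is in `Δ` since it is below `dist y x`.
  have hpow : ∀ n : ℕ, ∀ y ∈ S, ∀ x ∈ D, dist y x ≤ 2 ^ n * r → x ∈ S := by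
    intro n
    induction n with
    | zero =>
      intro y hy x hx hyx
      obtain ⟨z, hz1, hz2, hz3⟩ := hU.exists_midpoint C (hDC y (hSD y hy)) (x := x)
        (fun c hc => by rw [(hx c hc).1, (hSD y hy c hc).1]) hrΔ hr0 (hrC y (hSD y hy))
        (by rw [pow_zero, one_mul] at hyx; linarith)
      have hzD : z ∈ D := fun c hc => by
        rw [(hz3 c hc).1, (hz3 c hc).2]
        exact hSD y hy c hc
      exact hstep z (hstep y hy z hzD (by rw [dist_comm, hz1])) x hx hz2
    | succ n ih =>
      intro y hy x hx hyx
      rcases le_or_gt (dist y x) (2 ^ n * r) with hle | hlt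
      · exact ih y hy x hx hle
      · have hpos : 0 < 2 ^ n * r := by positivity
        have hyxne : y ≠ x := fun h => by
          rw [h, dist_self] at hlt
          exact hlt.not_gt hpos
        have hmem := hΔ.two_pow_mul_mem hrΔ (hU.dist_mem y x hyxne) n hlt.le
        obtain ⟨z, hz1, hz2, hz3⟩ := hU.exists_midpoint C (hDC y (hSD y hy)) (x := x)
          (fun c hc => by rw [(hx c hc).1, (hSD y hy c hc).1]) hmem hpos
          (fun c hc => by
            have h3 := dist_triangle_right y x c
            rw [(hx c hc).1, ← (hSD y hy c hc).1] at h3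
            linarith)
          (by rw [pow_succ] at hyx; linarith)
        have hzD : z ∈ D := fun c hc => by
          rw [(hz3 c hc).1, (hz3 c hc).2]
          exact hSD y hy c hc
        exact ih z (ih y hy z hzD (by rw [dist_comm, hz1])) x hx hz2.le
  obtain ⟨n, hn⟩ := pow_unbounded_of_one_lt (dist a x / r) (one_lt_two (α := ℝ))
  exact hpow n a ⟨1, K.one_mem, one_smul _ _⟩ x (fun c hc => ⟨hd c hc, hl c hc⟩)
    ((div_lt_iff₀ hr0).1 hn).le

theorem IsUrysohn.isReconstructible [Countable U] (hU : IsUrysohn Δ U) (iU : Interprets Δ U)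
    (hΔ : IsDistanceValueSet Δ) (hne : Δ.Nonempty) :
    IsReconstructible (Aut (language Δ) U) U where
  isOpen_stabilizer := Aut.isOpen_stabilizer
  exists_fixingSubgroup_le := Aut.exists_fixingSubgroup_le
  smul_eq_of_maps := iU.smul_eq_of_maps
  exists_smul_ne := hU.exists_smul_ne iU hΔ hne
  eq_or_eq C a ha K h1 h2 := by
    by_cases h : ∃ g ∈ K, g • a ≠ a
    · obtain ⟨g, hg, hga⟩ := h
      refine Or.inr (le_antisymm h2 fun m hm => ?_)
      rw [mem_fixingSubgroup_iff] at hm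
      -- `K` reaches `m • a` and contains the stabiliser of `a` over `C`, so it contains `m`.
      obtain ⟨k, hk, hka⟩ := hU.exists_mem_smul_eq iU hΔ C a ha K h1 h2 hg hga (x := m • a)
        (fun c hc => by
          nth_rewrite 1 [← hm c hc]
          exact iU.dist_smul m a c)
        (fun c hc => by
          nth_rewrite 1 [← hm c hc]
          exact iU.smul_lt_smul m c a)
      have : k⁻¹ * m ∈ K := h1 (by
        rw [mem_fixingSubgroup_iff]
        rintro c (rfl | hc)
        · rw [mul_smul, ← hka, inv_smul_smul]
        · rw [mul_smul, hm c hc, inv_smul_eq_iff]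
          exact ((mem_fixingSubgroup_iff _).1 (h2 hk) c hc).symm)
      simpa using K.mul_mem hk this
    · push Not at h
      refine Or.inl (le_antisymm (fun k hk => ?_) h1)
      rw [mem_fixingSubgroup_iff]
      rintro c (rfl | hc)
      · exact h k hk
      · exact (mem_fixingSubgroup_iff _).1 (h2 hk) c hc

end Action

/-! ### Recovering the distances from the permutation group -/

section Recover

variable {Δ Λ : Set ℝ}

theorem IsUrysohn.nonempty {U : Type} [MetricSpace U] [LinearOrder U] (hU : IsUrysohn Δ U) :
    Nonempty U := by
  obtain ⟨u, -⟩ := hU.extension ∅ (fun _ => 0) (fun _ => True) (by simp) (by simp) (by simp)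
  exact ⟨u⟩

theorem IsUrysohn.exists_dist_eq {U : Type} [MetricSpace U] [LinearOrder U] (hU : IsUrysohn Δ U)
    (hΔ : IsDistanceValueSet Δ) (a : U) {s : ℝ} (hs : s ∈ Δ) : ∃ b, dist a b = s := by
  have hs0 := hΔ.pos s hs
  obtain ⟨b, hb⟩ := hU.extension {a} (fun _ => s) (fun _ => True) (by simpa using hs)
    (by simpa using hs0.le) (by simp)
  exact ⟨b, by rw [dist_comm]; exact (hb a (by simp)).1⟩

theorem IsUrysohn.exists_triangle {U : Type} [MetricSpace U] [LinearOrder U]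
    (hU : IsUrysohn Δ U) (hΔ : IsDistanceValueSet Δ) {x y z : ℝ} (h : IsTriangle Δ x y z) :
    ∃ a b c : U, dist a b = x ∧ dist b c = y ∧ dist a c = z := by
  classical
  obtain ⟨hx, hy, hz, h1, h2⟩ := h
  obtain ⟨a⟩ := hU.nonempty
  obtain ⟨b, hb⟩ := hU.exists_dist_eq hΔ a hx
  have hx0 := hΔ.pos x hx
  have hy0 := hΔ.pos y hy
  have hz0 := hΔ.pos z hz
  have hab : b ≠ a := fun h => by
    rw [h, dist_self] at hb
    exact hx0.ne hb
  rw [abs_le] at h1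
  let f : U → ℝ := fun u => if u = a then z else y
  have hfa : f a = z := if_pos rfl
  have hfb : f b = y := if_neg hab
  obtain ⟨c, hc⟩ := hU.extension {a, b} f (fun _ => True)
    (by
      simp only [Finset.forall_mem_insert, Finset.mem_singleton, forall_eq, hfa, hfb]
      exact ⟨hz, hy⟩)
    (by
      simp only [Finset.forall_mem_insert, Finset.mem_singleton, forall_eq, hfa, hfb, dist_self,
        dist_comm b a, hb, sub_self, abs_zero, le_refl, true_and]
      refine ⟨⟨by linarith, abs_le.2 ⟨?_, ?_⟩, ?_⟩, ⟨abs_le.2 ⟨?_, ?_⟩, ?_⟩, by linarith⟩ <;>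
        linarith)
    (by simp)
  exact ⟨a, b, c, hb, by rw [dist_comm, (hc b (by simp)).1, hfb],
    by rw [dist_comm, (hc a (by simp)).1, hfa]⟩

variable {U V : Type} [(language Δ).Structure U] [MetricSpace U] [LinearOrder U]
  [(language Λ).Structure V] [MetricSpace V] [LinearOrder V]

theorem IsUrysohn.exists_smul_pair [Countable U] (hU : IsUrysohn Δ U) (iU : Interprets Δ U)
    {x y x' y' : U} (h : dist x y = dist x' y') (h1 : x < y ↔ x' < y') (h2 : y < x ↔ y' < x') :
    ∃ g : Aut (language Δ) U, g • x = x' ∧ g • y = y' := by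
  classical
  let f : U → U := fun u => if u = x then x' else y'
  have hfx : f x = x' := if_pos rfl
  have hfy : f y = y' := by
    by_cases hxy : y = x
    · rw [hxy, dist_self, eq_comm, dist_eq_zero] at h
      rw [hxy, hfx, h]
    · exact if_neg hxy
  obtain ⟨g, hg⟩ := hU.exists_aut iU {x, y} f
    (by
      simp only [Finset.forall_mem_insert, Finset.mem_singleton, forall_eq, hfx, hfy, dist_self,
        true_and, and_true]
      exact ⟨h.symm, by rw [dist_comm, ← h, dist_comm]⟩)
    (by
      simp only [Finset.forall_mem_insert, Finset.mem_singleton, forall_eq, hfx, hfy,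
        lt_self_iff_false, true_and, and_true]
      exact ⟨h1.symm, h2.symm⟩)
  exact ⟨g, (hg x (by simp)).trans hfx, (hg y (by simp)).trans hfy⟩

theorem IsUrysohn.dist_eq_of_equivariant [Countable U] (hU : IsUrysohn Δ U)
    (iU : Interprets Δ U) (iV : Interprets Λ V) {β : U → V}
    {φ : Aut (language Δ) U → Aut (language Λ) V} (hβ : ∀ g a, β (g • a) = φ g • β a)
    {x y x' y' : U} (h : dist x y = dist x' y') :
    dist (β x) (β y) = dist (β x') (β y') := by
  rcases eq_or_ne x y with rfl | hxy
  · rw [dist_self, eq_comm, dist_eq_zero] at h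
    rw [h, dist_self, dist_self]
  · have hxy' : x' ≠ y' := fun h' => hxy (by rwa [h', dist_self, dist_eq_zero] at h)
    have key : ∀ u v : U, dist x y = dist u v → (x < y ↔ u < v) → (y < x ↔ v < u) →
        dist (β x) (β y) = dist (β u) (β v) := fun u v h h1 h2 => by
      obtain ⟨g, rfl, rfl⟩ := hU.exists_smul_pair iU h h1 h2
      rw [hβ, hβ, iV.dist_smul]
    by_cases hl : x < y ↔ x' < y'
    · refine key _ _ h hl ?_
      rw [← not_le, ← not_le, hxy.le_iff_lt, hxy'.le_iff_lt, hl]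
    -- If the two pairs are ordered oppositely, the second is reversed, which leaves its distance
    -- unchanged.
    · rw [dist_comm (β x')]
      rw [dist_comm x'] at h
      have h3 : (y < x ↔ ¬ x < y) := by rw [← not_le, hxy.le_iff_lt]
      have h4 : (y' < x' ↔ ¬ x' < y') := by rw [← not_le, hxy'.le_iff_lt]
      exact key _ _ h (by tauto) (by tauto)

theorem IsUrysohn.exists_distance_map [Countable U] (hU : IsUrysohn Δ U)
    (iU : Interprets Δ U) (iV : Interprets Λ V) (hΔ : IsDistanceValueSet Δ) {β : U → V}
    (hinj : Function.Injective β)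
    {φ : Aut (language Δ) U → Aut (language Λ) V} (hβ : ∀ g a, β (g • a) = φ g • β a) :
    ∃ f : Δ → Λ, ∀ (s : Δ) (a b : U), dist a b = s → dist (β a) (β b) = f s := by
  obtain ⟨u⟩ := hU.nonempty
  choose v hv using fun s : Δ => hU.exists_dist_eq hΔ u s.2
  refine ⟨fun s => ⟨dist (β u) (β (v s)), iV.dist_mem _ _ fun h => ?_⟩, fun s a b hab => ?_⟩
  · have := hv s
    rw [← hinj h, dist_self] at this
    exact (hΔ.pos _ s.2).ne this
  · exact hU.dist_eq_of_equivariant iU iV hβ (hab.trans (hv s).symm)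

-- A triangle is realised by three points of `U`, and the triangle inequalities hold for their
-- images.
omit [(language Δ).Structure U] [(language Λ).Structure V] [LinearOrder V] in
theorem IsUrysohn.isTriangle_map (hU : IsUrysohn Δ U) (hΔ : IsDistanceValueSet Δ) {β : U → V}
    {f : Δ → Λ} (hf : ∀ (s : Δ) (a b : U), dist a b = s → dist (β a) (β b) = f s)
    {x y z : Δ} (h : IsTriangle Δ x y z) : IsTriangle Λ (f x) (f y) (f z) := by
  obtain ⟨a, b, c, h1, h2, h3⟩ := hU.exists_triangle hΔ h
  refine ⟨(f x).2, (f y).2, (f z).2, ?_⟩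
  rw [← hf _ _ _ h1, ← hf _ _ _ h2, ← hf _ _ _ h3]
  refine ⟨?_, dist_triangle _ _ _⟩
  rw [dist_comm (β b)]
  exact abs_dist_sub_le (β a) (β c) (β b)

theorem IsUrysohn.equivalent_of_equivariant [Countable U] [Countable V] (hU : IsUrysohn Δ U)
    (hV : IsUrysohn Λ V) (iU : Interprets Δ U) (iV : Interprets Λ V)
    (hΔ : IsDistanceValueSet Δ) (hΛ : IsDistanceValueSet Λ) (β : U ≃ V)
    (φ : Aut (language Δ) U ≃ Aut (language Λ) V) (hβ : ∀ g a, β (g • a) = φ g • β a) :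
    Equivalent Δ Λ := by
  have hβ' : ∀ g a, β.symm (g • a) = φ.symm g • β.symm a := fun g a => by
    rw [Equiv.symm_apply_eq, hβ, φ.apply_symm_apply, β.apply_symm_apply]
  obtain ⟨f, hf⟩ := hU.exists_distance_map iU iV hΔ β.injective hβ
  obtain ⟨k, hk⟩ := hV.exists_distance_map iV iU hΛ β.symm.injective hβ'
  have hkf : ∀ s, k (f s) = s := fun s => by
    obtain ⟨u⟩ := hU.nonempty
    obtain ⟨v, hv⟩ := hU.exists_dist_eq hΔ u s.2
    have := hk _ _ _ (hf s u v hv)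
    rw [β.symm_apply_apply, β.symm_apply_apply, hv] at this
    exact Subtype.ext this.symm
  have hfk : ∀ s, f (k s) = s := fun s => by
    obtain ⟨u⟩ := hV.nonempty
    obtain ⟨v, hv⟩ := hV.exists_dist_eq hΛ u s.2
    have := hf _ _ _ (hk s u v hv)
    rw [β.apply_symm_apply, β.apply_symm_apply, hv] at this
    exact Subtype.ext this.symm
  refine ⟨⟨f, k, hkf, hfk⟩, fun x y z => ⟨hU.isTriangle_map hΔ hf, fun h => ?_⟩⟩
  have := hV.isTriangle_map hΛ hk h
  simpa only [Equiv.coe_fn_mk, hkf] using this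

end Recover

/-! ### Changing the distances along an equivalence -/

/-- A copy of a type, to carry another metric. -/
structure Relabelled (U : Type) where
  /-- The underlying point. -/
  val : U

/-- The points of a type as points of its copy. -/
def Relabelled.equiv (U : Type) : U ≃ Relabelled U :=
  ⟨Relabelled.mk, Relabelled.val, fun _ => rfl, fun _ => rfl⟩

/-- Both a metric and a Katětov function are governed by triangles alone. So `f` carries the metric
over, and an extension problem for `Λ` is pulled back along `f.symm`, solved in `U` and carried
forward. -/
theorem IsUrysohn.exists_change_distances {Δ Λ : Set ℝ} {U : Type} [MetricSpace U] [LinearOrder U]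
    (hU : IsUrysohn Δ U) (hΔ : IsDistanceValueSet Δ) (hΛ : IsDistanceValueSet Λ) (f : Δ ≃ Λ)
    (hf : ∀ x y z : Δ, IsTriangle Δ x y z ↔ IsTriangle Λ (f x) (f y) (f z)) :
    ∃ (W : Type) (_ : MetricSpace W) (_ : LinearOrder W) (e : U ≃ W),
      (∀ x y x' y', dist (e x) (e y) = dist (e x') (e y') ↔ dist x y = dist x' y') ∧
      (∀ x y, e x < e y ↔ x < y) ∧ IsUrysohn Λ W := by
  classical
  let d' : U → U → ℝ := fun x y => if h : x = y then 0 else f ⟨dist x y, hU.dist_mem x y h⟩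
  have hself : ∀ x, d' x x = 0 := fun x => dif_pos rfl
  have hne : ∀ x y (h : x ≠ y), d' x y = f ⟨dist x y, hU.dist_mem x y h⟩ := fun x y h => dif_neg h
  have hmem : ∀ x y, x ≠ y → d' x y ∈ Λ := fun x y h => hne x y h ▸ (f _).2
  have hpos : ∀ x y, x ≠ y → 0 < d' x y := fun x y h => hΛ.pos _ (hmem x y h)
  have hcomm : ∀ x y, d' x y = d' y x := fun x y => by
    rcases eq_or_ne x y with rfl | h
    · rfl
    · rw [hne x y h, hne y x h.symm]
      simp only [dist_comm]
  have htri : ∀ x y z, d' x z ≤ d' x y + d' y z := fun x y z => by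
    rcases eq_or_ne x y with rfl | hxy
    · rw [hself, zero_add]
    rcases eq_or_ne y z with rfl | hyz
    · rw [hself, add_zero]
    rcases eq_or_ne x z with rfl | hxz
    · rw [hself]; exact (add_pos (hpos _ _ hxy) (hpos _ _ hyz)).le
    rw [hne x y hxy, hne y z hyz, hne x z hxz]
    refine ((hf ⟨dist x y, _⟩ ⟨dist y z, _⟩ ⟨dist x z, _⟩).1
      ⟨hU.dist_mem _ _ hxy, hU.dist_mem _ _ hyz, hU.dist_mem _ _ hxz, ?_,
        dist_triangle x y z⟩).2.2.2.2
    change |dist x y - dist y z| ≤ dist x z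
    rw [dist_comm y]
    exact abs_dist_sub_le x z y
  let iM : MetricSpace (Relabelled U) :=
    { dist := fun x y => d' x.val y.val
      dist_self := fun x => hself _
      dist_comm := fun x y => hcomm _ _
      dist_triangle := fun x y z => htri _ _ _
      eq_of_dist_eq_zero := fun {x y} h => by
        by_contra hxy
        exact (hpos x.val y.val ((Relabelled.equiv U).symm.injective.ne hxy)).ne' h }
  let iL : LinearOrder (Relabelled U) :=
    LinearOrder.lift' Relabelled.val (Relabelled.equiv U).symm.injective
  refine ⟨Relabelled U, iM, iL, Relabelled.equiv U, fun x y x' y' => ?_, fun _ _ => Iff.rfl,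
    fun x y hxy => hmem _ _ ((Relabelled.equiv U).symm.injective.ne hxy), fun F h P hh hk hP => ?_⟩
  · change d' x y = d' x' y' ↔ dist x y = dist x' y'
    rcases eq_or_ne x y with rfl | h <;> rcases eq_or_ne x' y' with rfl | h'
    · simp only [hself, dist_self]
    · simp only [hself, dist_self, (hpos _ _ h').ne, (dist_pos.2 h').ne]
    · simp only [hself, dist_self, (hpos _ _ h).ne', (dist_pos.2 h).ne']
    · rw [hne x y h, hne x' y' h', Subtype.coe_inj, f.apply_eq_iff_eq, Subtype.mk.injEq]
  -- The value `0` is never used on `F`, where `h` takes values in `Λ`.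
  · let h' : U → ℝ := fun u => if hu : h ⟨u⟩ ∈ Λ then f.symm ⟨h ⟨u⟩, hu⟩ else 0
    have hh' : ∀ x ∈ F, ∃ s : Δ, h' x.val = s ∧ h x = f s := fun x hx =>
      ⟨f.symm ⟨h x, hh x hx⟩, dif_pos (hh x hx), by rw [f.apply_symm_apply]⟩
    obtain ⟨z, hz⟩ := hU.extension (F.image Relabelled.val) h' (fun u => P ⟨u⟩)
      (by
        simp only [Finset.forall_mem_image]
        intro x hx
        obtain ⟨s, hs, -⟩ := hh' x hx
        exact hs ▸ s.2)
      (by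
        simp only [Finset.forall_mem_image]
        intro x hx y hy
        obtain ⟨s, hs, hs'⟩ := hh' x hx
        obtain ⟨t, ht, ht'⟩ := hh' y hy
        have hs0 := hΔ.pos _ s.2
        rcases eq_or_ne x y with rfl | hxy
        · rw [hs, sub_self, abs_zero, dist_self]
          exact ⟨le_rfl, by linarith⟩
        · have hxy' : x.val ≠ y.val := (Relabelled.equiv U).symm.injective.ne hxy
          have h3 : |h x - h y| ≤ d' x.val y.val ∧ d' x.val y.val ≤ h x + h y := hk x hx y hy
          rw [hs', ht', hne _ _ hxy'] at h3
          rw [hs, ht]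
          exact ((hf s t ⟨_, hU.dist_mem _ _ hxy'⟩).2
            ⟨(f s).2, (f t).2, (f _).2, h3⟩).2.2.2)
      (by
        simp only [Finset.forall_mem_image]
        exact fun x hx y hy hxy => hP x hx y hy hxy)
    refine ⟨⟨z⟩, fun x hx => ?_⟩
    obtain ⟨h1, h2⟩ := hz x.val (Finset.mem_image_of_mem _ hx)
    obtain ⟨s, hs, hs'⟩ := hh' x hx
    have hzx : z ≠ x.val := fun h => by
      rw [h, dist_self, hs] at h1
      exact (hΔ.pos _ s.2).ne h1
    refine ⟨?_, h2⟩
    change d' z x.val = h x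
    rw [hne _ _ hzx, hs']
    exact congrArg (fun s => (f s : ℝ)) (Subtype.ext (h1.trans hs))

/-! ### Conjugating automorphism groups, and the two implications -/

section Conjugation

variable {Δ Λ : Set ℝ} {U V : Type} [(language Δ).Structure U] [MetricSpace U] [LinearOrder U]
  [(language Λ).Structure V] [MetricSpace V] [LinearOrder V]

theorem Interprets.exists_conj (iU : Interprets Δ U) (iV : Interprets Λ V) (e : U ≃ V)
    (hd : ∀ x y x' y', dist x y = dist x' y' → dist (e x) (e y) = dist (e x') (e y'))
    (hl : ∀ x y, e x < e y ↔ x < y) (g : Aut (language Δ) U) :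
    ∃ k : Aut (language Λ) V, ∀ v, k • v = e (g • e.symm v) :=
  ⟨iV.equiv iV ((e.symm.trans (FirstOrder.Language.Equiv.toEquiv g)).trans e)
    (fun x y => by
      have := hd _ _ _ _ (iU.dist_smul g (e.symm x) (e.symm y))
      rwa [e.apply_symm_apply, e.apply_symm_apply] at this)
    (fun x y => by
      have := (hl _ _).trans (iU.smul_lt_smul g (e.symm x) (e.symm y))
      rwa [← hl (e.symm x), e.apply_symm_apply, e.apply_symm_apply] at this), fun _ => rfl⟩

theorem Aut.eq_of_smul_eq {L : FirstOrder.Language.{0, 0}} {M : Type} [L.Structure M]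
    {g h : Aut L M} (H : ∀ x : M, g • x = h • x) : g = h := Aut.ext H

theorem Interprets.nonempty_continuousMulEquiv (iU : Interprets Δ U) (iV : Interprets Λ V)
    (e : U ≃ V) (hd : ∀ x y x' y', dist (e x) (e y) = dist (e x') (e y') ↔ dist x y = dist x' y')
    (hl : ∀ x y, e x < e y ↔ x < y) :
    Nonempty (Aut (language Δ) U ≃ₜ* Aut (language Λ) V) := by
  choose F hF using iU.exists_conj iV e (fun x y x' y' => (hd x y x' y').2) hl
  choose K hK using iV.exists_conj iU e.symm
    (fun x y x' y' h => (hd _ _ _ _).1 (by simpa only [e.apply_symm_apply] using h))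
    (fun x y => by rw [← hl, e.apply_symm_apply, e.apply_symm_apply])
  have hcont : ∀ {X : Type} {A B : Type} [TopologicalSpace X] (p : A → B) (q : X → A),
      @Continuous X A _ ⊥ q → @Continuous X B _ ⊥ fun x => p (q x) := fun {X A B} _ p q hq => by
    let : TopologicalSpace A := ⊥
    let : TopologicalSpace B := ⊥
    have : DiscreteTopology A := ⟨rfl⟩
    exact continuous_of_discreteTopology.comp hq
  exact ⟨{
    toFun := F
    invFun := K
    left_inv := fun g => Aut.eq_of_smul_eq fun x => by simp [hK, hF]
    right_inv := fun g => Aut.eq_of_smul_eq fun x => by simp [hK, hF]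
    map_mul' := fun g h => Aut.eq_of_smul_eq fun x => by simp [mul_smul, hF]
    continuous_toFun := Aut.continuous_iff.2 fun x => by
      simp only [hF]
      exact hcont e _ (Aut.continuous_smul _)
    continuous_invFun := Aut.continuous_iff.2 fun x => by
      simp only [hK]
      exact hcont e.symm _ (Aut.continuous_smul _) }⟩

theorem IsUrysohn.nonempty_continuousMulEquiv [Countable U] [Countable V] (hU : IsUrysohn Δ U)
    (hV : IsUrysohn Λ V) (iU : Interprets Δ U) (iV : Interprets Λ V)
    (hΔ : IsDistanceValueSet Δ) (hΛ : IsDistanceValueSet Λ) (h : Equivalent Δ Λ) :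
    Nonempty (Aut (language Δ) U ≃ₜ* Aut (language Λ) V) := by
  obtain ⟨f, hf⟩ := h
  obtain ⟨W, iM, iL, e, hd, hl, hW⟩ := hU.exists_change_distances hΔ hΛ f hf
  have : Countable W := e.symm.injective.countable
  let := structureOfMetric Λ W
  have iW : Interprets Λ W := interprets_structureOfMetric hW.dist_mem
  obtain ⟨k⟩ := (hW.isFraisseLimit iW).nonempty_equiv (hV.isFraisseLimit iV)
  exact iU.nonempty_continuousMulEquiv iV (e.trans k.toEquiv)
    (fun x y x' y' => by
      rw [← hd]
      exact iff_of_eq (congrArg₂ Eq (iW.dist_map iV k _ _) (iW.dist_map iV k _ _)))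
    (fun x y => (iW.lt_map iV k _ _).trans (hl x y))

/-- The degenerate case outside `isReconstructible`: without distances `U` has one point and a
trivial group, whereas a nonempty `Λ` yields a nontrivial automorphism. -/
theorem IsUrysohn.eq_empty_of_continuousMulEquiv [Countable V] (hU : IsUrysohn Δ U)
    (hV : IsUrysohn Λ V) (iV : Interprets Λ V) (hΛ : IsDistanceValueSet Λ) (hΔ : Δ = ∅)
    (φ : Aut (language Δ) U ≃ₜ* Aut (language Λ) V) : Λ = ∅ := by
  by_contra hne
  have : Subsingleton U := ⟨fun x y => by
    by_contra h
    exact (hΔ ▸ hU.dist_mem x y h : dist x y ∈ (∅ : Set ℝ)).elim⟩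
  have hs : ∀ g : Aut (language Δ) U, g = 1 := fun g =>
    Aut.eq_of_smul_eq fun x => Subsingleton.elim _ _
  obtain ⟨v⟩ := hV.nonempty
  obtain ⟨g, -, hg⟩ := hV.exists_smul_ne iV hΛ (Set.nonempty_iff_ne_empty.2 hne) ∅ v (by simp)
  have h1 : g = 1 := by
    rw [← φ.apply_symm_apply g, hs (φ.symm g), map_one]
  exact hg (by rw [h1, one_smul])

theorem IsUrysohn.equivalent_of_continuousMulEquiv [Countable U] [Countable V]
    (hU : IsUrysohn Δ U) (hV : IsUrysohn Λ V) (iU : Interprets Δ U) (iV : Interprets Λ V)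
    (hΔ : IsDistanceValueSet Δ) (hΛ : IsDistanceValueSet Λ)
    (φ : Aut (language Δ) U ≃ₜ* Aut (language Λ) V) : Equivalent Δ Λ := by
  rcases Δ.eq_empty_or_nonempty with h | hne
  · have h' := hU.eq_empty_of_continuousMulEquiv hV iV hΛ h φ
    have : IsEmpty Δ := Set.isEmpty_coe_sort.2 h
    have : IsEmpty Λ := Set.isEmpty_coe_sort.2 h'
    exact ⟨Equiv.equivOfIsEmpty _ _, fun x => isEmptyElim x⟩
  · have hne' : Λ.Nonempty := Set.nonempty_iff_ne_empty.2 fun h =>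
      hne.ne_empty (hV.eq_empty_of_continuousMulEquiv hU iU hΔ h φ.symm)
    obtain ⟨β, hβ⟩ := (hU.isReconstructible iU hΔ hne).exists_equiv
      (hV.isReconstructible iV hΛ hne') φ
    exact hU.equivalent_of_equivariant hV iU iV hΔ hΛ β φ.toEquiv hβ

end Conjugation

end OrderedUrysohn

/-! ### The theorem -/

open OrderedUrysohn in
theorem theorem1p5 (Δ Λ : Set ℝ)
    (hΔ : IsDistanceValueSet Δ) (hΛ : IsDistanceValueSet Λ)
    (hΔc : Δ.Countable) (hΛc : Λ.Countable) :
    (∃ (U : Type) (_ : (language Δ).Structure U), IsOrderedUrysohnSpace Δ U) ∧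
    (∃ (V : Type) (_ : (language Λ).Structure V), IsOrderedUrysohnSpace Λ V) ∧
    ∀ (U V : Type) [(language Δ).Structure U] [(language Λ).Structure V],
      IsOrderedUrysohnSpace Δ U → IsOrderedUrysohnSpace Λ V →
      (Nonempty (Aut (language Δ) U ≃ₜ* Aut (language Λ) V) ↔ Equivalent Δ Λ) := by
  refine ⟨exists_isOrderedUrysohnSpace hΔ hΔc, exists_isOrderedUrysohnSpace hΛ hΛc, ?_⟩
  intro U V _ _ hU hV
  obtain ⟨_, _, iU, hU'⟩ := hU.exists_isUrysohn hΔ hΔc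
  obtain ⟨_, _, iV, hV'⟩ := hV.exists_isUrysohn hΛ hΛc
  have := hU.1
  have := hV.1
  exact ⟨fun ⟨φ⟩ => hU'.equivalent_of_continuousMulEquiv hV' iU iV hΔ hΛ φ,
    hU'.nonempty_continuousMulEquiv hV' iU iV hΔ hΛ⟩
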